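/- **Theorem (weak bisimulation between RL and RL$^+$).** *Evidence.* Let $\mathrm{Ev}$ be a set of evidence objects $\varepsilon$ and $\mathrm{Label}$ a set of labels $l$, with a partial composition $\varepsilon_1 \mathbin{;} \varepsilon_2$, functions $\mathit{idom},\mathit{icod} : \mathrm{FunEv} \to \mathrm{Ev}$ on a subset $\mathrm{FunEv}\subseteq\mathrm{Ev}$, and a function $\mathit{iproj} : \mathrm{IProjDomain} \to \mathrm{Ev}$ on a subset of $\mathrm{Ev}\times\mathrm{Label}$. Total evidence is $b ::= \bot \mid \varepsilon$, and $b_1 \mathbin{;_\bot} b_2$ is $\varepsilon_1 \mathbin{;} \varepsilon_2$ if $b_1=\varepsilon_1$, $b_2=\varepsilon_2$ and this is defined, and $\bot$ otherwise. *Terms.* Let $a$ range over $\mathrm{Ev}$ for RL and over $\mathrm{Ev}\cup\{\bot\}$ for RL$^+$. The terms of both languages, up to renaming of bound variables, are $$e ::= n \mid \mathsf{true} \mid \mathsf{false} \mid x \mid \lambda x.e \mid (a\,e)\,(a\,e) \mid a\,e + a\,e \mid \mathsf{if}\ a\,e\ \mathsf{then}\ a\,e\ \mathsf{else}\ a\,e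 \mid \{l_1=e_1,\dots,l_k=e_k\} \mid (a\,e).l \mid a\,e$$ with $n\in\mathbb Z$ and distinct labels in a record; the last form is an ascription. In both languages the raw values are $u ::= n \mid \mathsf{true}\mid\mathsf{false} \mid x \mid \lambda x.e \mid \{\overline{l=v}\}$ and the values are $v ::= u \mid \varepsilon\,u$ (with $\varepsilon\neq\bot$). *Notions of reduction* (both languages): $\varepsilon_1 n_1 + \varepsilon_2 n_2 \leadsto n$ with $n$ the sum of $n_1$ and $n_2$; for $\varepsilon_1\in\mathrm{FunEv}$, $(\varepsilon_1\,\lambda x.e)\,(\varepsilon_2\,u) \leadsto \mathit{icod}(\varepsilon_1)\,([(\varepsilon_3 u)/x]e)$ if $\varepsilon_3 = \varepsilon_2 \mathbin{;} \mathit{idom}(\varepsilon_1)$ is defined, and $\leadsto\mathbf{error}$ if it is not; $\mathsf{if}\ \varepsilon\,\mathsf{true}\ \mathsf{then}\ a_2e_2\ \mathsf{else}\ a_3e_3 \leadsto a_2e_2$, and $\leadsto a_3e_3$ for $\mathsf{false}$; $(\varepsilon\{\overline{l_i=v_i}\}).l_j \leadsto \mathit{iproj}(\varepsilon,l_j)\,v_j$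 if $(\varepsilon,l_j)\in\mathrm{IProjDomain}$. *Reduction of RL.* Frames are $F ::= [] \mid F'$, where $$F' ::= []\,(a\,e) \mid (\varepsilon\,u)\,[] \mid [] + a\,e \mid \varepsilon\,u + [] \mid [].l \mid \mathsf{if}\ []\ \mathsf{then}\ a\,e\ \mathsf{else}\ a\,e ,$$ and evaluation contexts are $E ::= [] \mid E[\{\overline{l=v},l=[],\overline{l=e}\}] \mid E[F[\varepsilon\,[]]]$. The steps are: $E[e]\to E[e']$ if $e\leadsto e'$; $E[e]\to\mathbf{error}$ if $e\leadsto\mathbf{error}$; $E[F[\varepsilon_1(\varepsilon_2 u)]]\to E[F[(\varepsilon_2\mathbin{;}\varepsilon_1)u]]$ if the composition is defined; $E[F[\varepsilon_1(\varepsilon_2 u)]]\to\mathbf{error}$ if it is not. *Reduction of RL$^+$.* The frames are the $F'$ above (no empty frame); contexts are $G ::= [] \mid E[F'[\,]] \mid E[\{\overline{l=v},l=[],\overline{l=e}\}]$ and $E ::= G \mid G[b\,[]]$, used only where plugging gives a term. The steps are: $E[e]\to^{+} E[e']$ if $e\leadsto e'$; $E[e]\to^{+}\mathbf{error}$ if $e\leadsto\mathbf{error}$;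 $G[b_1(b_2\,e)]\to^{+} G[(b_2\mathbin{;_\bot} b_1)\,e]$; $G[\bot\,u]\to^{+}\mathbf{error}$. *The relation $\approx$* between RL terms or $\mathbf{error}$ and RL$^+$ terms or $\mathbf{error}$ is the least one such that: - (Sim-Casts) if $n,m\ge1$, neither $e_1$ nor $e_2$ is an ascription, $e_1\approx e_2$, and $\varepsilon_n \mathbin{;_\bot} (\cdots \mathbin{;_\bot} (\varepsilon_2\mathbin{;_\bot}\varepsilon_1)) = ((b_m \mathbin{;_\bot} \cdots) \mathbin{;_\bot} b_2)\mathbin{;_\bot} b_1$, then $\varepsilon_1(\cdots(\varepsilon_n\,e_1)) \approx b_1(\cdots(b_m\,e_2))$; - $\mathbf{error}\approx\mathbf{error}$, and $u\approx u$ for every raw value $u$ of RL (regarded as an RL$^+$ term on the right); - two applications, two additions, two conditionals, or two projections with the same label are related if their annotated immediate subterms, regarded as ascriptions, are pairwise related; two records with the same labels are related if their fields are pairwise related. *Claim.* Assume evidence composition is associative: $(b_1\mathbin{;_\bot}b_2)\mathbin{;_\bot}b_3 = b_1\mathbin{;_\bot}(b_2\mathbin{;_\bot}b_3)$ for all total evidence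 $b_1,b_2,b_3$. Then $\approx$ is a weak bisimulation between $\to$ and $\to^{+}$: whenever $c_1\approx c_2$, - if $c_1\to c_1'$, then there is $c_2'$ such that $c_2$ reduces to $c_2'$ in zero or more $\to^{+}$ steps and $c_1'\approx c_2'$; - if $c_2\to^{+} c_2'$, then there is $c_1'$ such that $c_1$ reduces to $c_1'$ in zero or more $\to$ steps and $c_1'\approx c_2'$. Here $c_1,c_1'$ range over RL terms and $\mathbf{error}$, and $c_2,c_2'$ over RL$^+$ terms and $\mathbf{error}$. -/

import Mathlib

universe u v w

/-- An evidence abstraction: a carrier `Ev` of evidence objects with partial composition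
(consistent transitivity) and the evidence inversion operators, each of which is a total function
on its own subdomain of evidence.  No law is imposed on these operations. -/
structure EvidenceAbstraction (Ev : Type*) (Label : Type*) where
  /-- `comp ε₁ ε₂` is `ε₁ ; ε₂`, and `none` where the composition is not defined. -/
  comp : Ev → Ev → Option Ev
  /-- evidence relating function types -/
  FunEv : Set Ev
  idom : FunEv → Ev
  icod : FunEv → Ev
  /-- pairs of evidence relating record types that both have the given field -/
  IProjDomain : Set (Ev × Label)
  iproj : IProjDomain → Ev

/-- Composition of total evidence; `none` is the latent failure `⊥`. -/
def EvidenceAbstraction.totalComp {Ev Label : Type*} (S : EvidenceAbstraction Ev Label) :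
    Option Ev → Option Ev → Option Ev
  | some ε₁, some ε₂ => S.comp ε₁ ε₂
  | _, _ => none

/-- Associativity of evidence composition, as an equation between total compositions. -/
def EvidenceAbstraction.CompAssoc {Ev Label : Type*} (S : EvidenceAbstraction Ev Label) : Prop :=
  ∀ b₁ b₂ b₃ : Option Ev,
    S.totalComp (S.totalComp b₁ b₂) b₃ = S.totalComp b₁ (S.totalComp b₂ b₃)

/-- Runtime terms whose evidence annotations are drawn from `A`: the terms of RL are
`RTerm Ev Label`, those of RL⁺ are `RTerm (Option Ev) Label`.  Variables are de Bruijn indices;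
a record is a finite sequence of fields with pairwise distinct labels. -/
inductive RTerm (A : Type*) (Label : Type*) where
  | int (n : ℤ)
  | bool (b : Bool)
  | var (x : ℕ)
  | lam (e : RTerm A Label)
  | app (a₁ : A) (e₁ : RTerm A Label) (a₂ : A) (e₂ : RTerm A Label)
  | plus (a₁ : A) (e₁ : RTerm A Label) (a₂ : A) (e₂ : RTerm A Label)
  | ite (a₁ : A) (e₁ : RTerm A Label) (a₂ : A) (e₂ : RTerm A Label) (a₃ : A) (e₃ : RTerm A Label)
  | rcd {n : ℕ} (ls : Fin n ↪ Label) (es : Fin n → RTerm A Label)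
  | proj (a : A) (e : RTerm A Label) (l : Label)
  | asc (a : A) (e : RTerm A Label)

namespace RTerm

/-- Apply `f` to every evidence annotation. -/
def mapEv {A B Label : Type*} (f : A → B) : RTerm A Label → RTerm B Label
  | int n => int n
  | bool b => bool b
  | var x => var x
  | lam e => lam (mapEv f e)
  | app a₁ e₁ a₂ e₂ => app (f a₁) (mapEv f e₁) (f a₂) (mapEv f e₂)
  | plus a₁ e₁ a₂ e₂ => plus (f a₁) (mapEv f e₁) (f a₂) (mapEv f e₂)
  | ite a₁ e₁ a₂ e₂ a₃ e₃ => ite (f a₁) (mapEv f e₁) (f a₂) (mapEv f e₂) (f a₃) (mapEv f e₃)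
  | rcd ls es => rcd ls (fun i => mapEv f (es i))
  | proj a e l => proj (f a) (mapEv f e) l
  | asc a e => asc (f a) (mapEv f e)

/-- Extend a renaming under a binder. -/
def upRen (ρ : ℕ → ℕ) : ℕ → ℕ
  | 0 => 0
  | x + 1 => ρ x + 1

def rename {A Label : Type*} (ρ : ℕ → ℕ) : RTerm A Label → RTerm A Label
  | int n => int n
  | bool b => bool b
  | var x => var (ρ x)
  | lam e => lam (rename (upRen ρ) e)
  | app a₁ e₁ a₂ e₂ => app a₁ (rename ρ e₁) a₂ (rename ρ e₂)
  | plus a₁ e₁ a₂ e₂ => plus a₁ (rename ρ e₁) a₂ (rename ρ e₂)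
  | ite a₁ e₁ a₂ e₂ a₃ e₃ => ite a₁ (rename ρ e₁) a₂ (rename ρ e₂) a₃ (rename ρ e₃)
  | rcd ls es => rcd ls (fun i => rename ρ (es i))
  | proj a e l => proj a (rename ρ e) l
  | asc a e => asc a (rename ρ e)

/-- Extend a substitution under a binder. -/
def upSubst {A Label : Type*} (σ : ℕ → RTerm A Label) : ℕ → RTerm A Label
  | 0 => var 0
  | x + 1 => rename Nat.succ (σ x)

/-- Capture-avoiding simultaneous substitution. -/
def subst {A Label : Type*} (σ : ℕ → RTerm A Label) : RTerm A Label → RTerm A Label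
  | int n => int n
  | bool b => bool b
  | var x => σ x
  | lam e => lam (subst (upSubst σ) e)
  | app a₁ e₁ a₂ e₂ => app a₁ (subst σ e₁) a₂ (subst σ e₂)
  | plus a₁ e₁ a₂ e₂ => plus a₁ (subst σ e₁) a₂ (subst σ e₂)
  | ite a₁ e₁ a₂ e₂ a₃ e₃ => ite a₁ (subst σ e₁) a₂ (subst σ e₂) a₃ (subst σ e₃)
  | rcd ls es => rcd ls (fun i => subst σ (es i))
  | proj a e l => proj a (subst σ e) l
  | asc a e => asc a (subst σ e)

/-- `inst v e` is `[v/x]e` for the body `e` of `λx.e`. -/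
def inst {A Label : Type*} (v e : RTerm A Label) : RTerm A Label :=
  subst (fun x => Nat.casesOn x v var) e

/-- The term is an ascription `a e`. -/
def IsAsc {A Label : Type*} (e : RTerm A Label) : Prop := ∃ a e', e = asc a e'

/-- The stack of ascriptions `a₁ (a₂ ⋯ (aₙ e))`. -/
def ascStack {A Label : Type*} (as : List A) (e : RTerm A Label) : RTerm A Label :=
  as.foldr asc e

end RTerm

/-- A configuration: a term or the result `error`. -/
inductive Conf (A : Type*) (Label : Type*) where
  | term (e : RTerm A Label)
  | error

/-! The following notions are common to both languages.  The map `ι : Ev → A` says how ordinary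
evidence occurs as an annotation: `ι = id` for RL and `ι = some` for RL⁺. -/

mutual
/-- Raw values `u`. -/
inductive IsRaw {Ev : Type u} {A : Type v} {Label : Type w} (ι : Ev → A) : RTerm A Label → Prop
  | int (n : ℤ) : IsRaw ι (.int n)
  | bool (b : Bool) : IsRaw ι (.bool b)
  | var (x : ℕ) : IsRaw ι (.var x)
  | lam (e : RTerm A Label) : IsRaw ι (.lam e)
  | rcd {n : ℕ} (ls : Fin n ↪ Label) (es : Fin n → RTerm A Label)
      (h : ∀ i, IsValue ι (es i)) : IsRaw ι (.rcd ls es)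
/-- Values `v`: a raw value `u`, or `ε u` with ordinary evidence `ε`. -/
inductive IsValue {Ev : Type u} {A : Type v} {Label : Type w} (ι : Ev → A) : RTerm A Label → Prop
  | raw (u : RTerm A Label) (h : IsRaw ι u) : IsValue ι u
  | asc (ε : Ev) (u : RTerm A Label) (h : IsRaw ι u) : IsValue ι (.asc (ι ε) u)
end

/-- Notions of reduction `e ⇝ e'` and `e ⇝ error`. -/
inductive Notion {Ev A Label : Type*} (S : EvidenceAbstraction Ev Label) (ι : Ev → A) :
    RTerm A Label → Conf A Label → Prop
  | plus (ε₁ ε₂ : Ev) (n₁ n₂ : ℤ) :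
      Notion S ι (.plus (ι ε₁) (.int n₁) (ι ε₂) (.int n₂)) (.term (.int (n₁ + n₂)))
  | beta (ε₁ ε₂ ε₃ : Ev) (e u : RTerm A Label) (h₁ : ε₁ ∈ S.FunEv) (hu : IsRaw ι u)
      (h₃ : S.comp ε₂ (S.idom ⟨ε₁, h₁⟩) = some ε₃) :
      Notion S ι (.app (ι ε₁) (.lam e) (ι ε₂) u)
        (.term (.asc (ι (S.icod ⟨ε₁, h₁⟩)) (RTerm.inst (.asc (ι ε₃) u) e)))
  | betaError (ε₁ ε₂ : Ev) (e u : RTerm A Label) (h₁ : ε₁ ∈ S.FunEv) (hu : IsRaw ι u)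
      (h₃ : S.comp ε₂ (S.idom ⟨ε₁, h₁⟩) = none) :
      Notion S ι (.app (ι ε₁) (.lam e) (ι ε₂) u) .error
  | iteTrue (ε₁ : Ev) (a₂ : A) (e₂ : RTerm A Label) (a₃ : A) (e₃ : RTerm A Label) :
      Notion S ι (.ite (ι ε₁) (.bool true) a₂ e₂ a₃ e₃) (.term (.asc a₂ e₂))
  | iteFalse (ε₁ : Ev) (a₂ : A) (e₂ : RTerm A Label) (a₃ : A) (e₃ : RTerm A Label) :
      Notion S ι (.ite (ι ε₁) (.bool false) a₂ e₂ a₃ e₃) (.term (.asc a₃ e₃))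
  | proj (ε : Ev) {n : ℕ} (ls : Fin n ↪ Label) (es : Fin n → RTerm A Label) (j : Fin n)
      (hv : ∀ i, IsValue ι (es i)) (h : (ε, ls j) ∈ S.IProjDomain) :
      Notion S ι (.proj (ι ε) (.rcd ls es) (ls j))
        (.term (.asc (ι (S.iproj ⟨(ε, ls j), h⟩)) (es j)))

/-- Frames of the elimination forms.  The hole stands for an annotated term `a e`.  An operand
that is already evaluated carries ordinary evidence; operands and branches that are still pending
carry an arbitrary annotation. -/
inductive Frame {Ev A : Type*} (Label : Type*) (ι : Ev → A) where
  | appL (a₂ : A) (e₂ : RTerm A Label)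
  | appR (ε₁ : Ev) (u₁ : RTerm A Label) (h : IsRaw ι u₁)
  | plusL (a₂ : A) (e₂ : RTerm A Label)
  | plusR (ε₁ : Ev) (u₁ : RTerm A Label) (h : IsRaw ι u₁)
  | proj (l : Label)
  | ite (a₂ : A) (e₂ : RTerm A Label) (a₃ : A) (e₃ : RTerm A Label)

/-- `F.fill a e` is `F[a e]`. -/
def Frame.fill {Ev A Label : Type*} {ι : Ev → A} :
    Frame Label ι → A → RTerm A Label → RTerm A Label
  | appL a₂ e₂, a, e => .app a e a₂ e₂
  | appR ε₁ u₁ _, a, e => .app (ι ε₁) u₁ a e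
  | plusL a₂ e₂, a, e => .plus a e a₂ e₂
  | plusR ε₁ u₁ _, a, e => .plus (ι ε₁) u₁ a e
  | proj l, a, e => .proj a e l
  | ite a₂ e₂ a₃ e₃, a, e => .ite a e a₂ e₂ a₃ e₃

namespace RL

/-- Evidence frames of RL: the empty frame, or a frame of an elimination form. -/
inductive EvFrame (Ev Label : Type*) where
  | hole
  | elim (F : Frame Label (id : Ev → Ev))

def EvFrame.fill {Ev Label : Type*} : EvFrame Ev Label → Ev → RTerm Ev Label → RTerm Ev Label
  | hole, ε, e => .asc ε e
  | elim F, ε, e => F.fill ε e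

/-- Evaluation contexts `E ::= [] | E[{l = v, …, l = [], l = e, …}] | E[F[ε []]]` of RL; in the
record case the hole is at position `i` and the entry of `es` there is irrelevant. -/
inductive ECtxt (Ev Label : Type*) where
  | hole
  | rcd (E : ECtxt Ev Label) {n : ℕ} (ls : Fin n ↪ Label) (es : Fin n → RTerm Ev Label) (i : Fin n)
      (hv : ∀ j, j < i → IsValue (id : Ev → Ev) (es j))
  | frame (E : ECtxt Ev Label) (F : EvFrame Ev Label) (ε : Ev)

def ECtxt.plug {Ev Label : Type*} : ECtxt Ev Label → RTerm Ev Label → RTerm Ev Label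
  | hole, e => e
  | rcd E ls es i _, e => E.plug (.rcd ls (Function.update es i e))
  | frame E F ε, e => E.plug (F.fill ε e)

/-- Contextual reduction of RL. -/
inductive Step {Ev Label : Type*} (S : EvidenceAbstraction Ev Label) :
    Conf Ev Label → Conf Ev Label → Prop
  | notion (E : ECtxt Ev Label) (e e' : RTerm Ev Label) (h : Notion S id e (.term e')) :
      Step S (.term (E.plug e)) (.term (E.plug e'))
  | notionError (E : ECtxt Ev Label) (e : RTerm Ev Label) (h : Notion S id e .error) :
      Step S (.term (E.plug e)) .error
  | comp (E : ECtxt Ev Label) (F : EvFrame Ev Label) (ε₁ ε₂ ε : Ev) (u : RTerm Ev Label)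
      (hu : IsRaw (id : Ev → Ev) u) (h : S.comp ε₂ ε₁ = some ε) :
      Step S (.term (E.plug (F.fill ε₁ (.asc ε₂ u)))) (.term (E.plug (F.fill ε u)))
  | compError (E : ECtxt Ev Label) (F : EvFrame Ev Label) (ε₁ ε₂ : Ev) (u : RTerm Ev Label)
      (hu : IsRaw (id : Ev → Ev) u) (h : S.comp ε₂ ε₁ = none) :
      Step S (.term (E.plug (F.fill ε₁ (.asc ε₂ u)))) .error

end RL

namespace RLPlus

/-- What may be put in the hole of a context: any term, or, when the hole is directly inside a
frame, only an annotated term `b e`. -/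
inductive HoleKind where
  | any
  | annotated

def Filler (Ev : Type u) (Label : Type v) : HoleKind → Type (max u v)
  | .any => RTerm (Option Ev) Label
  | .annotated => Option Ev × RTerm (Option Ev) Label

/-- `b e` as a filler; it fits every hole. -/
def Filler.asc {Ev Label : Type*} :
    (k : HoleKind) → Option Ev → RTerm (Option Ev) Label → Filler Ev Label k
  | .any, b, e => RTerm.asc b e
  | .annotated, b, e => (b, e)

mutual
/-- Evaluation contexts of RL⁺ without an innermost ascription:
`G ::= [] | E[F[ [] ]] | E[{l = v, …, l = [], l = e, …}]`. -/
inductive ACtxt (Ev : Type u) (Label : Type v) : HoleKind → Type (max u v)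
  | hole : ACtxt Ev Label .any
  | frame (E : ECtxt Ev Label) (F : Frame Label (some : Ev → Option Ev)) : ACtxt Ev Label .annotated
  | rcd (E : ECtxt Ev Label) {n : ℕ} (ls : Fin n ↪ Label) (es : Fin n → RTerm (Option Ev) Label)
      (i : Fin n) (hv : ∀ j, j < i → IsValue (some : Ev → Option Ev) (es j)) : ACtxt Ev Label .any
/-- Evaluation contexts of RL⁺: `E ::= G | G[b []]`. -/
inductive ECtxt (Ev : Type u) (Label : Type v) : Type (max u v)
  | plain (G : ACtxt Ev Label .any) : ECtxt Ev Label
  | asc {k : HoleKind} (G : ACtxt Ev Label k) (b : Option Ev) : ECtxt Ev Label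
end

mutual
def ACtxt.plug {Ev : Type u} {Label : Type v} :
    {k : HoleKind} → ACtxt Ev Label k → Filler Ev Label k → RTerm (Option Ev) Label
  | _, .hole, e => e
  | _, .frame E F, (b, e) => E.plug (F.fill b e)
  | _, .rcd E ls es i _, e => E.plug (.rcd ls (Function.update es i e))
def ECtxt.plug {Ev : Type u} {Label : Type v} :
    ECtxt Ev Label → RTerm (Option Ev) Label → RTerm (Option Ev) Label
  | .plain G, e => G.plug e
  | .asc (k := k) G b, e => G.plug (Filler.asc k b e)
end

/-- `G.plugAsc b e` is `G[b e]`. -/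
def ACtxt.plugAsc {Ev Label : Type*} {k : HoleKind} (G : ACtxt Ev Label k) (b : Option Ev)
    (e : RTerm (Option Ev) Label) : RTerm (Option Ev) Label :=
  G.plug (Filler.asc k b e)

/-- Contextual reduction of RL⁺. -/
inductive Step {Ev Label : Type*} (S : EvidenceAbstraction Ev Label) :
    Conf (Option Ev) Label → Conf (Option Ev) Label → Prop
  | notion (E : ECtxt Ev Label) (e e' : RTerm (Option Ev) Label)
      (h : Notion S some e (.term e')) :
      Step S (.term (E.plug e)) (.term (E.plug e'))
  | notionError (E : ECtxt Ev Label) (e : RTerm (Option Ev) Label) (h : Notion S some e .error) :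
      Step S (.term (E.plug e)) .error
  | comp {k : HoleKind} (G : ACtxt Ev Label k) (b₁ b₂ : Option Ev) (e : RTerm (Option Ev) Label) :
      Step S (.term (G.plugAsc b₁ (.asc b₂ e))) (.term (G.plugAsc (S.totalComp b₂ b₁) e))
  | latentError {k : HoleKind} (G : ACtxt Ev Label k) (u : RTerm (Option Ev) Label)
      (hu : IsRaw (some : Ev → Option Ev) u) :
      Step S (.term (G.plugAsc none u)) .error

end RLPlus

/-- For a stack `b₁, b₂, …, bₙ` (outermost first), `bₙ ; (⋯ ; (b₂ ; b₁))`. -/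
def EvidenceAbstraction.rightTotal {Ev Label : Type*} (S : EvidenceAbstraction Ev Label) :
    Option Ev → List (Option Ev) → Option Ev
  | b₁, [] => b₁
  | b₁, b₂ :: bs => S.rightTotal (S.totalComp b₂ b₁) bs

/-- For a stack `b₁, b₂, …, bₘ` (outermost first), `((bₘ ; ⋯) ; b₂) ; b₁`. -/
def EvidenceAbstraction.leftTotal {Ev Label : Type*} (S : EvidenceAbstraction Ev Label) :
    Option Ev → List (Option Ev) → Option Ev
  | b₁, [] => b₁
  | b₁, b₂ :: bs => S.totalComp (S.leftTotal b₂ bs) b₁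

/-- The relation `≈` between terms of RL and terms of RL⁺. -/
inductive Sim {Ev Label : Type*} (S : EvidenceAbstraction Ev Label) :
    RTerm Ev Label → RTerm (Option Ev) Label → Prop
  | casts (ε : Ev) (εs : List Ev) (b : Option Ev) (bs : List (Option Ev))
      (e₁ : RTerm Ev Label) (e₂ : RTerm (Option Ev) Label)
      (h₁ : ¬ e₁.IsAsc) (h₂ : ¬ e₂.IsAsc) (h : Sim S e₁ e₂)
      (heq : S.rightTotal (some ε) (εs.map some) = S.leftTotal b bs) :
      Sim S (RTerm.ascStack (ε :: εs) e₁) (RTerm.ascStack (b :: bs) e₂)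
  | raw (u : RTerm Ev Label) (hu : IsRaw (id : Ev → Ev) u) : Sim S u (u.mapEv some)
  | app (ε₁ ε₂ : Ev) (b₃ b₄ : Option Ev) (e₁ e₂ : RTerm Ev Label) (e₃ e₄ : RTerm (Option Ev) Label)
      (h₁ : Sim S (.asc ε₁ e₁) (.asc b₃ e₃)) (h₂ : Sim S (.asc ε₂ e₂) (.asc b₄ e₄)) :
      Sim S (.app ε₁ e₁ ε₂ e₂) (.app b₃ e₃ b₄ e₄)
  | plus (ε₁ ε₂ : Ev) (b₃ b₄ : Option Ev) (e₁ e₂ : RTerm Ev Label) (e₃ e₄ : RTerm (Option Ev) Label)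
      (h₁ : Sim S (.asc ε₁ e₁) (.asc b₃ e₃)) (h₂ : Sim S (.asc ε₂ e₂) (.asc b₄ e₄)) :
      Sim S (.plus ε₁ e₁ ε₂ e₂) (.plus b₃ e₃ b₄ e₄)
  | ite (ε₁ ε₂ ε₃ : Ev) (b₄ b₅ b₆ : Option Ev) (e₁ e₂ e₃ : RTerm Ev Label)
      (e₄ e₅ e₆ : RTerm (Option Ev) Label)
      (h₁ : Sim S (.asc ε₁ e₁) (.asc b₄ e₄)) (h₂ : Sim S (.asc ε₂ e₂) (.asc b₅ e₅))
      (h₃ : Sim S (.asc ε₃ e₃) (.asc b₆ e₆)) :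
      Sim S (.ite ε₁ e₁ ε₂ e₂ ε₃ e₃) (.ite b₄ e₄ b₅ e₅ b₆ e₆)
  | proj (ε₁ : Ev) (b₂ : Option Ev) (e₁ : RTerm Ev Label) (e₂ : RTerm (Option Ev) Label) (l : Label)
      (h : Sim S (.asc ε₁ e₁) (.asc b₂ e₂)) :
      Sim S (.proj ε₁ e₁ l) (.proj b₂ e₂ l)
  | rcd {n : ℕ} (ls : Fin n ↪ Label) (es : Fin n → RTerm Ev Label)
      (es' : Fin n → RTerm (Option Ev) Label) (h : ∀ i, Sim S (es i) (es' i)) :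
      Sim S (.rcd ls es) (.rcd ls es')

/-- The relation `≈` between configurations of RL and of RL⁺. -/
inductive SimConf {Ev Label : Type*} (S : EvidenceAbstraction Ev Label) :
    Conf Ev Label → Conf (Option Ev) Label → Prop
  | term (e₁ : RTerm Ev Label) (e₂ : RTerm (Option Ev) Label) (h : Sim S e₁ e₂) :
      SimConf S (.term e₁) (.term e₂)
  | error : SimConf S .error .error

/-- `R` is a weak bisimulation between the unlabelled transition relations `r` and `s`: every step
of one side is matched by zero or more steps of the other side, and `R` holds again. -/
def IsWeakBisimulation {α β : Type*} (R : α → β → Prop) (r : α → α → Prop) (s : β → β → Prop) :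
    Prop :=
  ∀ a b, R a b →
    (∀ a', r a a' → ∃ b', Relation.ReflTransGen s b b' ∧ R a' b') ∧
    (∀ b', s b b' → ∃ a', Relation.ReflTransGen r a a' ∧ R a' b')

-- The calculi differ in how they merge stacked ascriptions. RL merges the two innermost ones, only
-- over a raw value, and fails as soon as their composition is undefined. RL⁺ merges the two
-- outermost ones, over any body, records an undefined composition as ⊥, and lets that failure
-- surface only when a single ⊥ meets a raw value. By associativity neither merge changes the total
-- evidence of the stack, and ⊥ is absorbing. So one side may merge while the other stands still,
-- and a merge failure on one side means total evidence ⊥ on the other, which fails too once its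
-- body is a raw value.
--
-- A λ-abstraction is related only to its own image under `mapEv some`. Hence when one side is a
-- value, the other evaluates to that same value up to the embedding
-- (`Sim.quietSteps_of_isValue_left`, `Sim.quietSteps_of_isValue_right`). Redexes then contract to a
-- term and its image, where `Sim.refl` applies, or to branches already related; no substitution
-- lemma for ≈ is needed. Reductions of subterms are matched by induction on ≈ (`Sim.forward`,
-- `Sim.backward`).
--
-- For that induction, contexts are replaced by the congruence rules of `ContextRed`, and matching
-- sequences have the form `Reaches`: every step but the last keeps the presence or absence of an
-- outer ascription. This lets sequences be lifted, since RL⁺ does not reduce under two adjacent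
-- ascriptions and a frame needs an annotated term in its hole.

/-! ### Structural presentation of contextual reduction -/

namespace Conf

variable {A B Label : Type*}

/-- Apply `f` to the term of a configuration. -/
def map (f : RTerm A Label → RTerm B Label) : Conf A Label → Conf B Label
  | term e => term (f e)
  | error => error

/-- Rebuild a configuration `a e` with `K`; other terms do not matter. -/
def mapAsc (K : A → RTerm A Label → RTerm A Label) : Conf A Label → Conf A Label
  | term (.asc a e) => term (K a e)
  | _ => error

/-- The configuration is `error` or an ascription. -/
inductive AscOrError : Conf A Label → Prop
  | asc (a : A) (e : RTerm A Label) : AscOrError (term (.asc a e))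
  | error : AscOrError error

/-- `a e` for a defined pair, `error` otherwise. -/
def ofAnnotated : Option (A × RTerm A Label) → Conf A Label
  | some p => term (.asc p.1 p.2)
  | none => error

theorem map_id_eq (c : Conf A Label) : c.map (fun e => e) = c := by cases c <;> rfl

theorem AscOrError.mapAsc_asc {c : Conf A Label} (h : AscOrError c) : c.mapAsc RTerm.asc = c := by
  cases h <;> rfl

theorem AscOrError.map_mapAsc {c : Conf A Label} (h : AscOrError c)
    (f : RTerm A Label → RTerm A Label) (K : A → RTerm A Label → RTerm A Label) :
    (c.mapAsc K).map f = c.mapAsc (fun a e => f (K a e)) := by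
  cases h <;> rfl

theorem AscOrError.mapAsc_map_asc {c : Conf A Label} (h : AscOrError c)
    (f : RTerm A Label → RTerm A Label) :
    c.mapAsc (fun a e => f (.asc a e)) = c.map f := by
  cases h <;> rfl

theorem mapAsc_map (c : Conf A Label) (a : A) (K : A → RTerm A Label → RTerm A Label) :
    (c.map (RTerm.asc a)).mapAsc K = c.map (K a) := by
  cases c <;> rfl

theorem map_map (c : Conf A Label) (f g : RTerm A Label → RTerm A Label) :
    (c.map f).map g = c.map (fun e => g (f e)) := by
  cases c <;> rfl

theorem ascOrError_map_asc (c : Conf A Label) (a : A) : AscOrError (c.map (RTerm.asc a)) := by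
  cases c <;> constructor

theorem ascOrError_ofAnnotated (o : Option (A × RTerm A Label)) : AscOrError (ofAnnotated o) := by
  cases o <;> constructor

end Conf

/-- Contextual reduction, with contexts replaced by congruence rules.  `cast` gives the reductions
at an annotated term, and `deep` says whether reduction takes place under nested ascriptions. -/
inductive ContextRed {Ev A Label : Type*} (S : EvidenceAbstraction Ev Label) (ι : Ev → A)
    (deep : Prop) (cast : A → RTerm A Label → Option (A × RTerm A Label) → Prop) :
    RTerm A Label → Conf A Label → Prop
  | cast {a : A} {e : RTerm A Label} {o : Option (A × RTerm A Label)} (h : cast a e o) :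
      ContextRed S ι deep cast (.asc a e) (Conf.ofAnnotated o)
  | notion {e : RTerm A Label} {c : Conf A Label} (h : Notion S ι e c) :
      ContextRed S ι deep cast e c
  | asc {a : A} {e : RTerm A Label} {c : Conf A Label} (hd : e.IsAsc → deep)
      (h : ContextRed S ι deep cast e c) :
      ContextRed S ι deep cast (.asc a e) (c.map (RTerm.asc a))
  -- The equation `ht` keeps the defined function `F.fill` out of the index, so that case analysis
  -- does not have to unify with it.
  | frame (F : Frame Label ι) {a : A} {e t : RTerm A Label} {c : Conf A Label}
      (ht : t = F.fill a e) (h : ContextRed S ι deep cast (.asc a e) c) :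
      ContextRed S ι deep cast t (c.mapAsc F.fill)
  | rcd {n : ℕ} (ls : Fin n ↪ Label) (es : Fin n → RTerm A Label) (i : Fin n)
      (hv : ∀ j, j < i → IsValue ι (es j)) {c : Conf A Label}
      (h : ContextRed S ι deep cast (es i) c) :
      ContextRed S ι deep cast (.rcd ls es) (c.map fun e => .rcd ls (Function.update es i e))

-- Terms that are not ascriptions

section NotAsc

variable {Ev A Label : Type*} {ι : Ev → A}

theorem RTerm.isAsc_asc (a : A) (e : RTerm A Label) : (RTerm.asc a e).IsAsc := ⟨a, e, rfl⟩

theorem RTerm.not_isAsc_rcd {n : ℕ} (ls : Fin n ↪ Label) (es : Fin n → RTerm A Label) :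
    ¬ (RTerm.rcd ls es).IsAsc := by rintro ⟨a, e, h⟩; cases h

theorem Frame.not_isAsc_fill (F : Frame Label ι) (a : A) (e : RTerm A Label) :
    ¬ (F.fill a e).IsAsc := by
  rintro ⟨a', e', h⟩; cases F <;> cases h

theorem IsRaw.not_isAsc {u : RTerm A Label} (h : IsRaw ι u) : ¬ u.IsAsc := by
  rintro ⟨a, e, rfl⟩; cases h

theorem Notion.not_isAsc {S : EvidenceAbstraction Ev Label} {e : RTerm A Label}
    {c : Conf A Label} (h : Notion S ι e c) : ¬ e.IsAsc := by
  rintro ⟨a, e, rfl⟩; cases h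

theorem IsValue.isRaw {v : RTerm A Label} (h : IsValue ι v) (hn : ¬ v.IsAsc) : IsRaw ι v := by
  cases h with
  | raw _ h => exact h
  | asc ε u h => exact absurd (RTerm.isAsc_asc _ _) hn

theorem isValue_asc_inv {a : A} {e : RTerm A Label} (h : IsValue ι (.asc a e)) :
    IsRaw ι e ∧ ∃ ε, a = ι ε := by
  generalize ht : RTerm.asc a e = t at h
  cases h with
  | raw _ h => subst ht; cases h
  | asc ε u h => cases ht; exact ⟨h, ε, rfl⟩

end NotAsc

namespace ContextRed

variable {Ev A Label : Type*} {S : EvidenceAbstraction Ev Label} {ι : Ev → A} {deep : Prop}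
  {cast : A → RTerm A Label → Option (A × RTerm A Label) → Prop}

/-- Guarantees that the junk value of `Conf.mapAsc` on terms other than ascriptions is never taken
in the rule `frame`. -/
theorem ascOrError {a : A} {e : RTerm A Label} {c : Conf A Label}
    (h : ContextRed S ι deep cast (.asc a e) c) : c.AscOrError := by
  generalize ht : RTerm.asc a e = t at h
  cases h with
  | cast h => exact Conf.ascOrError_ofAnnotated _
  | notion h => exact absurd ⟨_, _, ht.symm⟩ h.not_isAsc
  | asc hd h => exact Conf.ascOrError_map_asc _ _
  | frame F ht' h => subst ht'; exact absurd ⟨_, _, ht.symm⟩ (F.not_isAsc_fill _ _)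
  | rcd => cases ht

end ContextRed

-- Equivalence of contexts and congruence rules for RL

namespace RL

variable {Ev Label : Type*} {S : EvidenceAbstraction Ev Label}

/-- Reduction of `ε₁ (ε₂ u)`. -/
def CastRule (S : EvidenceAbstraction Ev Label) (ε₁ : Ev) (e : RTerm Ev Label)
    (o : Option (Ev × RTerm Ev Label)) : Prop :=
  ∃ ε₂ u, e = .asc ε₂ u ∧ IsRaw (id : Ev → Ev) u ∧ o = (S.comp ε₂ ε₁).map (·, u)

/-- Structural form of the reduction of RL. -/
abbrev Red (S : EvidenceAbstraction Ev Label) : RTerm Ev Label → Conf Ev Label → Prop :=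
  ContextRed S id True (CastRule S)

theorem Red.fill {F : EvFrame Ev Label} {ε : Ev} {e : RTerm Ev Label} {c : Conf Ev Label}
    (h : Red S (.asc ε e) c) : Red S (F.fill ε e) (c.mapAsc F.fill) := by
  cases F with
  | hole =>
    have := h.ascOrError.mapAsc_asc
    change Red S (.asc ε e) (c.mapAsc RTerm.asc)
    rwa [this]
  | elim F => exact .frame F rfl h

/-- Contexts grow at the hole, so each layer is added to the term before the outer context is
applied; this is why `e` and `c` are generalized. -/
theorem Red.plug {e : RTerm Ev Label} {c : Conf Ev Label} (E : ECtxt Ev Label)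
    (h : Red S e c) : Red S (E.plug e) (c.map E.plug) := by
  induction E generalizing e c with
  | hole => simpa [ECtxt.plug, Conf.map_id_eq] using h
  | rcd E ls es i hv ih =>
    have h' : Red S (.rcd ls (Function.update es i e))
        (c.map fun e' => .rcd ls (Function.update (Function.update es i e) i e')) := by
      refine .rcd ls _ i (fun j hj => ?_) (by simpa using h)
      rw [Function.update_of_ne hj.ne]
      exact hv j hj
    have := ih h'
    simpa [Conf.map_map, ECtxt.plug] using this
  | frame E F ε ih =>
    have h' := ih (Red.fill (F := F) (.asc (a := ε) (fun _ => trivial) h))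
    rw [Conf.mapAsc_map, Conf.map_map] at h'
    exact h'

theorem Step.red {e : RTerm Ev Label} {c : Conf Ev Label} (h : Step S (.term e) c) : Red S e c := by
  generalize ht : Conf.term e = t at h
  cases h with
  | notion E e e' h => cases ht; exact Red.plug E (.notion h)
  | notionError E e h => cases ht; exact Red.plug E (.notion h)
  | comp E F ε₁ ε₂ ε u hu h =>
    cases ht
    exact Red.plug E (Red.fill (.cast (o := some (ε, u)) ⟨ε₂, u, rfl, hu, by simp [h]⟩))
  | compError E F ε₁ ε₂ u hu h =>
    cases ht
    exact Red.plug E (Red.fill (.cast (o := none) ⟨ε₂, u, rfl, hu, by simp [h]⟩))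

/-- The second clause strengthens the induction: `F.fill a e'` absorbs the annotation and does not
contain `a e'` as a subterm, so the first clause alone says nothing about steps of `a e'` inside a
frame. -/
theorem Red.step_plug {e : RTerm Ev Label} {c : Conf Ev Label} (h : Red S e c) :
    (∀ E : ECtxt Ev Label, Step S (.term (E.plug e)) (c.map E.plug)) ∧
      ∀ a e', e = .asc a e' → ∀ (E : ECtxt Ev Label) (F : EvFrame Ev Label),
        Step S (.term (E.plug (F.fill a e'))) ((c.mapAsc F.fill).map E.plug) := by
  induction h with
  | @cast a e o h =>
    obtain ⟨ε₂, u, rfl, hu, rfl⟩ := h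
    have key : ∀ (E : ECtxt Ev Label) (F : EvFrame Ev Label),
        Step S (.term (E.plug (F.fill a (.asc ε₂ u))))
          (((Conf.ofAnnotated ((S.comp ε₂ a).map (·, u))).mapAsc F.fill).map E.plug) := by
      intro E F
      cases hc : S.comp ε₂ a with
      | none => exact .compError E F a ε₂ u hu hc
      | some ε => exact .comp E F a ε₂ ε u hu hc
    refine ⟨fun E => ?_, ?_⟩
    · have := key E .hole
      change Step S _ ((Conf.mapAsc RTerm.asc _).map E.plug) at this
      rwa [(Conf.ascOrError_ofAnnotated _).mapAsc_asc] at this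
    · rintro _ _ ⟨⟩ E F
      exact key E F
  | @notion e c h =>
    refine ⟨fun E => ?_, fun a e' he => absurd ⟨_, _, he⟩ h.not_isAsc⟩
    cases c with
    | term e' => exact .notion E _ _ h
    | error => exact .notionError E _ h
  | @asc a e c hd h ih =>
    refine ⟨fun E => ?_, ?_⟩
    · have := ih.1 (.frame E .hole a)
      rw [Conf.map_map]
      exact this
    · rintro _ _ ⟨⟩ E F
      have := ih.1 (.frame E F a)
      rw [Conf.mapAsc_map, Conf.map_map]
      exact this
  | @frame F a e t c ht h ih =>
    subst ht
    exact ⟨fun E => ih.2 a e rfl E (.elim F),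
      fun a' e' he => absurd ⟨_, _, he⟩ (F.not_isAsc_fill _ _)⟩
  | @rcd n ls es i hv c h ih =>
    refine ⟨fun E => ?_, fun a e' he => absurd ⟨_, _, he⟩ (RTerm.not_isAsc_rcd _ _)⟩
    have := ih.1 (.rcd E ls es i hv)
    rw [Conf.map_map]
    simpa [ECtxt.plug] using this

theorem Red.step {e : RTerm Ev Label} {c : Conf Ev Label} (h : Red S e c) : Step S (.term e) c := by
  simpa [ECtxt.plug, Conf.map_id_eq] using h.step_plug.1 .hole

end RL

-- Equivalence of contexts and congruence rules for RL⁺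

namespace RLPlus

variable {Ev Label : Type*} {S : EvidenceAbstraction Ev Label}

/-- Reduction of `b₁ (b₂ e)` and of `⊥ u`. -/
def CastRule (S : EvidenceAbstraction Ev Label) (b₁ : Option Ev) (e : RTerm (Option Ev) Label)
    (o : Option (Option Ev × RTerm (Option Ev) Label)) : Prop :=
  (∃ b₂ e', e = .asc b₂ e' ∧ o = some (S.totalComp b₂ b₁, e')) ∨
    b₁ = none ∧ IsRaw (some : Ev → Option Ev) e ∧ o = none

/-- Structural form of the reduction of RL⁺. -/
abbrev Red (S : EvidenceAbstraction Ev Label) :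
    RTerm (Option Ev) Label → Conf (Option Ev) Label → Prop :=
  ContextRed S some False (CastRule S)

theorem Red.rcd_update {n : ℕ} {ls : Fin n ↪ Label} {es : Fin n → RTerm (Option Ev) Label}
    {i : Fin n} (hv : ∀ j, j < i → IsValue (some : Ev → Option Ev) (es j))
    {e : RTerm (Option Ev) Label} {c : Conf (Option Ev) Label} (h : Red S e c) :
    Red S (.rcd ls (Function.update es i e)) (c.map fun e' => .rcd ls (Function.update es i e')) := by
  have h' : Red S (.rcd ls (Function.update es i e))
      (c.map fun e' => .rcd ls (Function.update (Function.update es i e) i e')) := by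
    refine .rcd ls _ i (fun j hj => ?_) (by simpa using h)
    rw [Function.update_of_ne hj.ne]
    exact hv j hj
  simpa using h'

mutual
-- The recursion follows that of `ACtxt` and `ECtxt`. In `Red.plug` the plugged term must not be an
-- ascription, because `E` may end in an ascription; annotated terms go through `Red.plugAsc`
-- instead.
theorem Red.plugAsc {k : HoleKind} (G : ACtxt Ev Label k) {b : Option Ev}
    {e : RTerm (Option Ev) Label} {c : Conf (Option Ev) Label} (h : Red S (.asc b e) c) :
    Red S (G.plugAsc b e) (c.mapAsc G.plugAsc) := by
  match k, G with
  | _, .hole =>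
    have := h.ascOrError.mapAsc_asc
    change Red S (.asc b e) (c.mapAsc RTerm.asc)
    rwa [this]
  | _, .frame E F =>
    have := Red.plug E (F.not_isAsc_fill _ _) (ContextRed.frame F rfl h)
    rw [h.ascOrError.map_mapAsc] at this
    exact this
  | _, .rcd E ls es i hv =>
    have := Red.plug E (RTerm.not_isAsc_rcd _ _) (Red.rcd_update (ls := ls) hv h)
    rw [Conf.map_map, ← h.ascOrError.mapAsc_map_asc] at this
    exact this
theorem Red.plug (E : ECtxt Ev Label) {e : RTerm (Option Ev) Label}
    {c : Conf (Option Ev) Label} (hn : ¬ e.IsAsc) (h : Red S e c) :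
    Red S (E.plug e) (c.map E.plug) := by
  match E with
  | .plain .hole =>
    have := Conf.map_id_eq c
    change Red S e (c.map fun e => e)
    rwa [this]
  | .plain (.rcd E ls es i hv) =>
    have := Red.plug E (RTerm.not_isAsc_rcd _ _) (Red.rcd_update (ls := ls) hv h)
    rw [Conf.map_map] at this
    exact this
  | .asc G b =>
    have := Red.plugAsc G (.asc (a := b) (fun h => absurd h hn) h)
    rw [Conf.mapAsc_map] at this
    exact this
end

theorem Step.red {e : RTerm (Option Ev) Label} {c : Conf (Option Ev) Label}
    (h : Step S (.term e) c) : Red S e c := by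
  generalize ht : Conf.term e = t at h
  cases h with
  | notion E e e' h => cases ht; exact Red.plug E h.not_isAsc (.notion h)
  | notionError E e h => cases ht; exact Red.plug E h.not_isAsc (.notion h)
  | comp G b₁ b₂ e =>
    cases ht
    exact Red.plugAsc G (.cast (o := some _) (.inl ⟨_, _, rfl, rfl⟩))
  | latentError G u hu =>
    cases ht
    exact Red.plugAsc G (.cast (o := none) (.inr ⟨rfl, hu, rfl⟩))

theorem Red.step_plug {e : RTerm (Option Ev) Label} {c : Conf (Option Ev) Label} (h : Red S e c) :
    (¬ e.IsAsc → ∀ E : ECtxt Ev Label, Step S (.term (E.plug e)) (c.map E.plug)) ∧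
      ∀ a e', e = .asc a e' → ∀ (k : HoleKind) (G : ACtxt Ev Label k),
        Step S (.term (G.plugAsc a e')) (c.mapAsc G.plugAsc) := by
  induction h with
  | @cast a e o h =>
    refine ⟨fun hn => absurd (RTerm.isAsc_asc _ _) hn, ?_⟩
    rintro _ _ ⟨⟩ k G
    obtain ⟨b₂, e', rfl, rfl⟩ | ⟨rfl, hu, rfl⟩ := h
    · exact .comp G a b₂ e'
    · exact .latentError G e hu
  | @notion e c h =>
    refine ⟨fun _ E => ?_, fun a e' he => absurd ⟨_, _, he⟩ h.not_isAsc⟩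
    cases c with
    | term e' => exact .notion E _ _ h
    | error => exact .notionError E _ h
  | @asc a e c hd h ih =>
    refine ⟨fun hn => absurd (RTerm.isAsc_asc _ _) hn, ?_⟩
    rintro _ _ ⟨⟩ k G
    -- With `deep` false, `hd` says exactly that the body is not an ascription.
    have := ih.1 hd (.asc G a)
    rw [Conf.mapAsc_map]
    exact this
  | @frame F a e t c ht h ih =>
    subst ht
    refine ⟨fun _ E => ?_, fun a' e' he => absurd ⟨_, _, he⟩ (F.not_isAsc_fill _ _)⟩
    have := ih.2 a e rfl _ (.frame E F)
    rw [h.ascOrError.map_mapAsc]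
    exact this
  | @rcd n ls es i hv c h ih =>
    refine ⟨fun _ E => ?_, fun a e' he => absurd ⟨_, _, he⟩ (RTerm.not_isAsc_rcd _ _)⟩
    rw [Conf.map_map]
    have hes : E.plug (.rcd ls es) = E.plug (.rcd ls (Function.update es i (es i))) := by
      rw [Function.update_eq_self]
    rw [hes]
    -- A field that is an ascription is handled by the record context as a `G`, any other field by
    -- the same context as an `E`.
    by_cases hn : (es i).IsAsc
    · obtain ⟨a, e', he⟩ := hn
      have := ih.2 a e' he _ (.rcd E ls es i hv)
      rw [he] at h ⊢
      rw [← h.ascOrError.mapAsc_map_asc]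
      exact this
    · exact ih.1 hn (.plain (.rcd E ls es i hv))

theorem Red.step {e : RTerm (Option Ev) Label} {c : Conf (Option Ev) Label} (h : Red S e c) :
    Step S (.term e) c := by
  by_cases hn : e.IsAsc
  · obtain ⟨a, e', rfl⟩ := hn
    have := h.step_plug.2 a e' rfl _ .hole
    change Step S (.term (.asc a e')) (c.mapAsc RTerm.asc) at this
    rwa [h.ascOrError.mapAsc_asc] at this
  · have := h.step_plug.1 hn (.plain .hole)
    change Step S (.term e) (c.map fun e => e) at this
    rwa [Conf.map_id_eq] at this

end RLPlus

/-! ### Total evidence of a stack of ascriptions -/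

namespace EvidenceAbstraction

variable {Ev Label : Type*} (S : EvidenceAbstraction Ev Label)

/-- Composition of total evidence with a unit `none` adjoined, in the order of stacks. -/
def stackMul : Option (Option Ev) → Option (Option Ev) → Option (Option Ev)
  | none, y => y
  | some a, none => some a
  | some a, some b => some (S.totalComp b a)

/-- The total evidence of a stack of ascriptions, outermost first; `none` for the empty stack. -/
def stackTotal : List (Option Ev) → Option (Option Ev)
  | [] => none
  | b :: bs => S.stackMul (some b) (stackTotal bs)

variable {S}

theorem stackMul_assoc (hassoc : S.CompAssoc) (x y z : Option (Option Ev)) :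
    S.stackMul (S.stackMul x y) z = S.stackMul x (S.stackMul y z) := by
  rcases x with _ | x <;> rcases y with _ | y <;> rcases z with _ | z <;>
    simp only [stackMul]
  rw [hassoc]

theorem stackTotal_append (hassoc : S.CompAssoc) (xs ys : List (Option Ev)) :
    S.stackTotal (xs ++ ys) = S.stackMul (S.stackTotal xs) (S.stackTotal ys) := by
  induction xs with
  | nil => rfl
  | cons x xs ih => simp only [List.cons_append, stackTotal, ih, stackMul_assoc hassoc]

theorem stackTotal_cons_eq_leftTotal (b : Option Ev) (bs : List (Option Ev)) :
    S.stackTotal (b :: bs) = some (S.leftTotal b bs) := by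
  induction bs generalizing b with
  | nil => rfl
  | cons b' bs ih => rw [stackTotal, ih]; rfl

theorem stackTotal_cons_cons (hassoc : S.CompAssoc) (b₁ b₂ : Option Ev) (bs : List (Option Ev)) :
    S.stackTotal (b₁ :: b₂ :: bs) = S.stackTotal (S.totalComp b₂ b₁ :: bs) := by
  simp only [stackTotal, ← stackMul_assoc hassoc]
  rfl

/-- `rightTotal` merges the two outermost annotations first, while `stackTotal` composes from the
inside; associativity reconciles them. `leftTotal` has the recursion of `stackTotal` and needs no
law. -/
theorem stackTotal_cons_eq_rightTotal (hassoc : S.CompAssoc) (b : Option Ev)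
    (bs : List (Option Ev)) : S.stackTotal (b :: bs) = some (S.rightTotal b bs) := by
  induction bs generalizing b with
  | nil => rfl
  | cons b' bs ih => rw [stackTotal_cons_cons hassoc, ih]; rfl

theorem stackTotal_eq_none {bs : List (Option Ev)} : S.stackTotal bs = none ↔ bs = [] := by
  cases bs with
  | nil => simp [stackTotal]
  | cons b bs => simp [stackTotal_cons_eq_leftTotal]

/-- Invariance under the merge of RL, at the bottom of a stack; `stackTotal_cons_cons` is the
counterpart for the merge of RL⁺, at the top. -/
theorem stackTotal_append_pair (hassoc : S.CompAssoc) (bs : List (Option Ev)) (b₁ b₂ : Option Ev) :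
    S.stackTotal (bs ++ [b₁, b₂]) = S.stackTotal (bs ++ [S.totalComp b₂ b₁]) := by
  rw [stackTotal_append hassoc, stackTotal_append hassoc, stackTotal_cons_cons hassoc]

/-- Outer ascriptions cannot repair a failed inner stack. -/
theorem totalComp_none_left (b : Option Ev) : S.totalComp none b = none := by
  cases b <;> rfl

end EvidenceAbstraction

/-! ### Embedding of RL terms into RL⁺ and the relation `≈` -/

namespace RTerm

variable {A B Label : Type*}

theorem mapEv_rename (f : A → B) (ρ : ℕ → ℕ) (e : RTerm A Label) :
    (e.rename ρ).mapEv f = (e.mapEv f).rename ρ := by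
  induction e generalizing ρ <;> simp_all [mapEv, rename]

theorem mapEv_upSubst (f : A → B) (σ : ℕ → RTerm A Label) :
    (fun x => (upSubst σ x).mapEv f) = upSubst fun x => (σ x).mapEv f := by
  funext x
  cases x with
  | zero => rfl
  | succ x => exact mapEv_rename f _ _

theorem mapEv_subst (f : A → B) (σ : ℕ → RTerm A Label) (e : RTerm A Label) :
    (e.subst σ).mapEv f = (e.mapEv f).subst fun x => (σ x).mapEv f := by
  induction e generalizing σ <;> simp_all [mapEv, subst, mapEv_upSubst]

theorem mapEv_inst (f : A → B) (v e : RTerm A Label) :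
    (inst v e).mapEv f = inst (v.mapEv f) (e.mapEv f) := by
  unfold inst
  rw [mapEv_subst]
  congr 1
  funext x
  cases x <;> rfl

theorem isAsc_mapEv {f : A → B} {e : RTerm A Label} : (e.mapEv f).IsAsc ↔ e.IsAsc := by
  constructor
  · rintro ⟨a, e', h⟩
    cases e <;> first | exact isAsc_asc _ _ | cases h
  · rintro ⟨a, e', rfl⟩
    exact isAsc_asc _ _

theorem ascStack_append (as as' : List A) (e : RTerm A Label) :
    ascStack (as ++ as') e = ascStack as (ascStack as' e) := by
  simp [ascStack]

theorem mapEv_eq_asc {f : A → B} {e : RTerm A Label} {b : B} {e' : RTerm B Label}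
    (h : e.mapEv f = .asc b e') : ∃ a u, e = .asc a u ∧ f a = b ∧ u.mapEv f = e' := by
  cases e <;> cases h
  exact ⟨_, _, rfl, rfl, rfl⟩

theorem mapEv_eq_lam {f : A → B} {e : RTerm A Label} {e' : RTerm B Label}
    (h : e.mapEv f = .lam e') : ∃ u, e = .lam u ∧ u.mapEv f = e' := by
  cases e <;> cases h
  exact ⟨_, rfl, rfl⟩

theorem mapEv_eq_int {f : A → B} {e : RTerm A Label} {n : ℤ}
    (h : e.mapEv f = .int n) : e = .int n := by
  cases e <;> cases h
  rfl

theorem mapEv_eq_bool {f : A → B} {e : RTerm A Label} {b : Bool}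
    (h : e.mapEv f = .bool b) : e = .bool b := by
  cases e <;> cases h
  rfl

theorem mapEv_eq_rcd {f : A → B} {e : RTerm A Label} {n : ℕ} {ls : Fin n ↪ Label}
    {es' : Fin n → RTerm B Label} (h : e.mapEv f = .rcd ls es') :
    ∃ es, e = .rcd ls es ∧ ∀ i, (es i).mapEv f = es' i := by
  cases e <;> cases h
  exact ⟨_, rfl, fun _ => rfl⟩

end RTerm

section MapEv

variable {Ev Label : Type*}

/-- Raw terms and values are mutually defined, so both claims go through one induction on the term;
away from ascriptions the second reduces to the first. -/
theorem isRaw_isValue_mapEv (e : RTerm Ev Label) :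
    (IsRaw (id : Ev → Ev) e → IsRaw (some : Ev → Option Ev) (e.mapEv some)) ∧
      (IsValue (id : Ev → Ev) e → IsValue (some : Ev → Option Ev) (e.mapEv some)) := by
  have lift : ∀ e : RTerm Ev Label, ¬ e.IsAsc →
      (IsRaw (id : Ev → Ev) e → IsRaw (some : Ev → Option Ev) (e.mapEv some)) →
      (IsRaw (id : Ev → Ev) e → IsRaw (some : Ev → Option Ev) (e.mapEv some)) ∧
      (IsValue (id : Ev → Ev) e → IsValue (some : Ev → Option Ev) (e.mapEv some)) :=
    fun e hn h => ⟨h, fun hv => .raw _ (h (hv.isRaw hn))⟩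
  induction e with
  | asc a e ih =>
    refine ⟨fun h => absurd (RTerm.isAsc_asc _ _) h.not_isAsc, fun h => ?_⟩
    exact .asc a _ (ih.1 (isValue_asc_inv h).1)
  | int n => exact lift _ (by rintro ⟨_, _, h⟩; cases h) fun _ => .int n
  | bool n => exact lift _ (by rintro ⟨_, _, h⟩; cases h) fun _ => .bool n
  | var n => exact lift _ (by rintro ⟨_, _, h⟩; cases h) fun _ => .var n
  | lam n => exact lift _ (by rintro ⟨_, _, h⟩; cases h) fun _ => .lam _
  | rcd ls es ih =>
    refine lift _ (RTerm.not_isAsc_rcd _ _) fun h => .rcd _ _ fun i => (ih i).2 ?_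
    cases h with
    | rcd _ _ h => exact h i
  | _ => exact lift _ (by rintro ⟨_, _, h⟩; cases h) fun h => nomatch h

theorem IsRaw.mapEv {e : RTerm Ev Label} (h : IsRaw (id : Ev → Ev) e) :
    IsRaw (some : Ev → Option Ev) (e.mapEv some) := (isRaw_isValue_mapEv e).1 h

theorem IsValue.mapEv {e : RTerm Ev Label} (h : IsValue (id : Ev → Ev) e) :
    IsValue (some : Ev → Option Ev) (e.mapEv some) := (isRaw_isValue_mapEv e).2 h

end MapEv

namespace Sim

variable {Ev Label : Type*} {S : EvidenceAbstraction Ev Label}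

/-- Every rule but `casts` is the case of two empty stacks. The adjoined unit of `stackTotal` lets a
single equation cover empty and nonempty stacks. -/
theorem exists_stacks (hassoc : S.CompAssoc) {e₁ : RTerm Ev Label} {e₂ : RTerm (Option Ev) Label}
    (h : Sim S e₁ e₂) : ∃ εs bs e₁' e₂', e₁ = RTerm.ascStack εs e₁' ∧ e₂ = RTerm.ascStack bs e₂' ∧
      ¬ e₁'.IsAsc ∧ ¬ e₂'.IsAsc ∧ Sim S e₁' e₂' ∧
      S.stackTotal (εs.map some) = S.stackTotal bs := by
  cases h with
  | casts ε εs b bs e₁ e₂ h₁ h₂ h heq =>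
    refine ⟨_, _, e₁, e₂, rfl, rfl, h₁, h₂, h, ?_⟩
    rw [List.map_cons, EvidenceAbstraction.stackTotal_cons_eq_rightTotal hassoc, heq,
      EvidenceAbstraction.stackTotal_cons_eq_leftTotal]
  | raw u hu =>
    exact ⟨[], [], _, _, rfl, rfl, hu.not_isAsc,
      RTerm.isAsc_mapEv.not.2 hu.not_isAsc,
      .raw _ hu, rfl⟩
  | app _ _ _ _ _ _ _ _ h₁ h₂ =>
    exact ⟨[], [], _, _, rfl, rfl, (by rintro ⟨_, _, h⟩; cases h), (by rintro ⟨_, _, h⟩; cases h),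
      .app _ _ _ _ _ _ _ _ h₁ h₂, rfl⟩
  | plus _ _ _ _ _ _ _ _ h₁ h₂ =>
    exact ⟨[], [], _, _, rfl, rfl, (by rintro ⟨_, _, h⟩; cases h), (by rintro ⟨_, _, h⟩; cases h),
      .plus _ _ _ _ _ _ _ _ h₁ h₂, rfl⟩
  | ite _ _ _ _ _ _ _ _ _ _ _ _ h₁ h₂ h₃ =>
    exact ⟨[], [], _, _, rfl, rfl, (by rintro ⟨_, _, h⟩; cases h), (by rintro ⟨_, _, h⟩; cases h),
      .ite _ _ _ _ _ _ _ _ _ _ _ _ h₁ h₂ h₃, rfl⟩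
  | proj _ _ _ _ l h =>
    exact ⟨[], [], _, _, rfl, rfl, (by rintro ⟨_, _, h⟩; cases h), (by rintro ⟨_, _, h⟩; cases h),
      .proj _ _ _ _ l h, rfl⟩
  | rcd ls es es' h =>
    exact ⟨[], [], _, _, rfl, rfl, RTerm.not_isAsc_rcd _ _, RTerm.not_isAsc_rcd _ _,
      .rcd ls es es' h, rfl⟩

/-- Stacks of ascriptions with the same total evidence preserve `≈`. -/
theorem ascStack (hassoc : S.CompAssoc) {e₁ : RTerm Ev Label} {e₂ : RTerm (Option Ev) Label}
    (h : Sim S e₁ e₂) {εs : List Ev} {bs : List (Option Ev)}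
    (heq : S.stackTotal (εs.map some) = S.stackTotal bs) :
    Sim S (RTerm.ascStack εs e₁) (RTerm.ascStack bs e₂) := by
  obtain ⟨εs', bs', e₁, e₂, rfl, rfl, h₁, h₂, h, heq'⟩ := h.exists_stacks hassoc
  rw [← RTerm.ascStack_append, ← RTerm.ascStack_append]
  replace heq : S.stackTotal ((εs ++ εs').map some) = S.stackTotal (bs ++ bs') := by
    rw [List.map_append, EvidenceAbstraction.stackTotal_append hassoc, heq, heq',
      EvidenceAbstraction.stackTotal_append hassoc]
  generalize εs ++ εs' = εs at heq
  generalize bs ++ bs' = bs at heq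
  -- Only the empty stack has total `none`, so both stacks are empty or neither is.
  cases εs with
  | nil =>
    obtain rfl := EvidenceAbstraction.stackTotal_eq_none.1 heq.symm
    exact h
  | cons ε εs =>
    cases bs with
    | nil => exact absurd (EvidenceAbstraction.stackTotal_eq_none.1 heq) (by simp)
    | cons b bs =>
      refine .casts _ _ _ _ _ _ h₁ h₂ h ?_
      rwa [List.map_cons, EvidenceAbstraction.stackTotal_cons_eq_rightTotal hassoc,
        EvidenceAbstraction.stackTotal_cons_eq_leftTotal, Option.some_inj] at heq

theorem asc (hassoc : S.CompAssoc) {e₁ : RTerm Ev Label} {e₂ : RTerm (Option Ev) Label}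
    (h : Sim S e₁ e₂) (ε : Ev) : Sim S (.asc ε e₁) (.asc (some ε) e₂) :=
  h.ascStack hassoc (εs := [ε]) (bs := [some ε]) rfl

/-- Once both sides hold the same values up to embedding, their contracta are a term and its image,
and this lemma relates them. -/
theorem refl (hassoc : S.CompAssoc) (e : RTerm Ev Label) : Sim S e (e.mapEv some) := by
  induction e with
  | int n => exact .raw _ (.int n)
  | bool b => exact .raw _ (.bool b)
  | var x => exact .raw _ (.var x)
  | lam e => exact .raw _ (.lam e)
  | app _ _ _ _ h₁ h₂ => exact .app _ _ _ _ _ _ _ _ (h₁.asc hassoc _) (h₂.asc hassoc _)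
  | plus _ _ _ _ h₁ h₂ => exact .plus _ _ _ _ _ _ _ _ (h₁.asc hassoc _) (h₂.asc hassoc _)
  | ite _ _ _ _ _ _ h₁ h₂ h₃ =>
    exact .ite _ _ _ _ _ _ _ _ _ _ _ _ (h₁.asc hassoc _) (h₂.asc hassoc _) (h₃.asc hassoc _)
  | rcd ls es ih => exact .rcd _ _ _ ih
  | proj _ _ _ h => exact .proj _ _ _ _ _ (h.asc hassoc _)
  | asc _ _ h => exact h.asc hassoc _

end Sim

/-! ### Reduction sequences that can be lifted into contexts -/

/-- A reduction step that neither creates nor removes a top-level ascription. -/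
def QuietStep {A Label : Type*} (R : RTerm A Label → Conf A Label → Prop)
    (e e' : RTerm A Label) : Prop :=
  R e (.term e') ∧ (e.IsAsc ↔ e'.IsAsc)

/-- Zero or more quiet steps. -/
abbrev QuietSteps {A Label : Type*} (R : RTerm A Label → Conf A Label → Prop) :
    RTerm A Label → RTerm A Label → Prop :=
  Relation.ReflTransGen (QuietStep R)

/-- Zero or more steps, all of them quiet except possibly the last one. -/
def Reaches {A Label : Type*} (R : RTerm A Label → Conf A Label → Prop)
    (e : RTerm A Label) (c : Conf A Label) : Prop :=
  ∃ e', QuietSteps R e e' ∧ (c = .term e' ∨ R e' c)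

section Reaches

variable {A Label : Type*} {R : RTerm A Label → Conf A Label → Prop}

theorem QuietSteps.isAsc_iff {e e' : RTerm A Label} (h : QuietSteps R e e') :
    e.IsAsc ↔ e'.IsAsc := by
  induction h with
  | refl => rfl
  | tail _ h ih => exact ih.trans h.2

theorem QuietSteps.reaches {e e' : RTerm A Label} (h : QuietSteps R e e') :
    Reaches R e (.term e') := ⟨e', h, .inl rfl⟩

theorem QuietSteps.trans_reaches {e e' : RTerm A Label} {c : Conf A Label}
    (h : QuietSteps R e e') (h' : Reaches R e' c) : Reaches R e c := by
  obtain ⟨e'', h'', hc⟩ := h'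
  exact ⟨e'', h.trans h'', hc⟩

theorem QuietSteps.trans_red {e e' : RTerm A Label} {c : Conf A Label}
    (h : QuietSteps R e e') (h' : R e' c) : Reaches R e c :=
  ⟨e', h, .inr h'⟩

theorem Reaches.reflTransGen {T : Conf A Label → Conf A Label → Prop}
    (hT : ∀ e c, R e c → T (.term e) c) {e : RTerm A Label} {c : Conf A Label}
    (h : Reaches R e c) : Relation.ReflTransGen T (.term e) c := by
  obtain ⟨e', h, hc⟩ := h
  have h' : Relation.ReflTransGen T (.term e) (.term e') :=
    Relation.ReflTransGen.lift Conf.term (fun _ _ h => hT _ _ h.1) _ _ h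
  rcases hc with rfl | hc
  · exact h'
  · exact h'.tail (hT _ _ hc)

end Reaches

namespace ContextRed

variable {Ev A Label : Type*} {S : EvidenceAbstraction Ev Label} {ι : Ev → A} {deep : Prop}
  {cast : A → RTerm A Label → Option (A × RTerm A Label) → Prop}

/-- Quiet steps preserve being an ascription, so the side condition `hd` need only be known for the
initial term. -/
theorem quietSteps_asc (a : A) {e e' : RTerm A Label}
    (h : QuietSteps (ContextRed S ι deep cast) e e') (hd : e.IsAsc → deep) :
    QuietSteps (ContextRed S ι deep cast) (.asc a e) (.asc a e') := by
  induction h with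
  | refl => exact .refl
  | tail h h' ih =>
    exact ih.tail ⟨.asc (fun hn => hd ((QuietSteps.isAsc_iff h).2 hn)) h'.1,
      iff_of_true (RTerm.isAsc_asc _ _) (RTerm.isAsc_asc _ _)⟩

theorem reaches_asc (a : A) {e : RTerm A Label} {c : Conf A Label}
    (h : Reaches (ContextRed S ι deep cast) e c) (hd : e.IsAsc → deep) :
    Reaches (ContextRed S ι deep cast) (.asc a e) (c.map (RTerm.asc a)) := by
  obtain ⟨e', h, rfl | hc⟩ := h
  · exact (quietSteps_asc a h hd).reaches
  · exact (quietSteps_asc a h hd).trans_red (.asc (fun hn => hd (h.isAsc_iff.2 hn)) hc)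

theorem quietSteps_fill (F : Frame Label ι) {a a' : A} {e e' : RTerm A Label}
    (h : QuietSteps (ContextRed S ι deep cast) (.asc a e) (.asc a' e')) :
    QuietSteps (ContextRed S ι deep cast) (F.fill a e) (F.fill a' e') := by
  generalize ht : RTerm.asc a' e' = t at h
  induction h generalizing a' e' with
  | refl => cases ht; exact .refl
  | @tail t₁ t₂ h h' ih =>
    subst ht
    -- Read backwards, quietness shows that the intermediate term is still an annotated term that
    -- the frame can hold.
    obtain ⟨a₁, e₁, rfl⟩ := h'.2.2 (RTerm.isAsc_asc _ _)
    exact (ih rfl).tail ⟨.frame F rfl h'.1,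
      iff_of_false (F.not_isAsc_fill _ _) (F.not_isAsc_fill _ _)⟩

theorem reaches_fill (F : Frame Label ι) {a : A} {e : RTerm A Label} {c : Conf A Label}
    (h : Reaches (ContextRed S ι deep cast) (.asc a e) c) :
    Reaches (ContextRed S ι deep cast) (F.fill a e) (c.mapAsc F.fill) := by
  obtain ⟨t, h, hc⟩ := h
  obtain ⟨a', e', rfl⟩ := h.isAsc_iff.1 (RTerm.isAsc_asc _ _)
  rcases hc with rfl | hc
  · exact (quietSteps_fill F h).reaches
  · exact (quietSteps_fill F h).trans_red (.frame F rfl hc)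

theorem reaches_ascOrError {a : A} {e : RTerm A Label} {c : Conf A Label}
    (h : Reaches (ContextRed S ι deep cast) (.asc a e) c) : c.AscOrError := by
  obtain ⟨t, h, hc⟩ := h
  obtain ⟨a', e', rfl⟩ := h.isAsc_iff.1 (RTerm.isAsc_asc _ _)
  rcases hc with rfl | hc
  · exact .asc _ _
  · exact hc.ascOrError

theorem quietSteps_rcd_update {n : ℕ} (ls : Fin n ↪ Label) (es : Fin n → RTerm A Label) (i : Fin n)
    (hv : ∀ j, j < i → IsValue ι (es j)) {e e' : RTerm A Label}
    (h : QuietSteps (ContextRed S ι deep cast) e e') :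
    QuietSteps (ContextRed S ι deep cast) (.rcd ls (Function.update es i e))
      (.rcd ls (Function.update es i e')) := by
  induction h with
  | refl => exact .refl
  | @tail e₁ e₂ h h' ih =>
    refine ih.tail ⟨?_, iff_of_false (RTerm.not_isAsc_rcd _ _) (RTerm.not_isAsc_rcd _ _)⟩
    have := ContextRed.rcd (S := S) (deep := deep) (cast := cast) (c := .term e₂) ls
      (Function.update es i e₁) i
      (fun j hj => by rw [Function.update_of_ne hj.ne]; exact hv j hj) (by simpa using h'.1)
    simpa [Conf.map] using this

/-- The first `k` fields of a record can be evaluated from left to right. -/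
theorem quietSteps_rcd {n : ℕ} (ls : Fin n ↪ Label) (es es' : Fin n → RTerm A Label) (k : ℕ)
    (h : ∀ i : Fin n, (i : ℕ) < k →
      QuietSteps (ContextRed S ι deep cast) (es i) (es' i) ∧ IsValue ι (es' i)) :
    QuietSteps (ContextRed S ι deep cast) (.rcd ls es)
      (.rcd ls fun i => if (i : ℕ) < k then es' i else es i) := by
  induction k with
  | zero => simp; exact .refl
  | succ k ih =>
    refine (ih fun i hi => h i (hi.trans k.lt_succ_self)).trans ?_
    by_cases hk : k < n
    -- The fields before position `k` are already values, as the record rule requires for reducing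
    -- field `k`.
    · have := quietSteps_rcd_update ls (fun i => if (i : ℕ) < k then es' i else es i) ⟨k, hk⟩
        (fun j hj => by
          have hj' : (j : ℕ) < k := hj
          simpa [hj'] using (h j (hj'.trans k.lt_succ_self)).2) (h ⟨k, hk⟩ k.lt_succ_self).1
      convert this using 2
      · funext i
        by_cases hi : i = ⟨k, hk⟩
        · subst hi; simp
        · rw [Function.update_of_ne hi]
      · funext i
        by_cases hi : i = ⟨k, hk⟩
        · subst hi; simp
        · rw [Function.update_of_ne hi]
          have : (i : ℕ) ≠ k := fun h => hi (Fin.ext h)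
          have : (i : ℕ) < k + 1 ↔ (i : ℕ) < k := by omega
          simp [this]
    -- Past the last field the two conditionals agree at every index.
    · have : ∀ i : Fin n, ((i : ℕ) < k + 1) ↔ ((i : ℕ) < k) := fun i => by omega
      simp only [this]
      exact .refl

/-- A field of a record can be reduced once all fields before it are evaluated. -/
theorem reaches_rcd {n : ℕ} (ls : Fin n ↪ Label) (es es' : Fin n → RTerm A Label) (i : Fin n)
    (h : ∀ j, j < i →
      QuietSteps (ContextRed S ι deep cast) (es j) (es' j) ∧ IsValue ι (es' j))
    {c : Conf A Label} (hc : Reaches (ContextRed S ι deep cast) (es i) c) :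
    Reaches (ContextRed S ι deep cast) (.rcd ls es)
      (c.map fun e => .rcd ls (Function.update (fun j => if j < i then es' j else es j) i e)) := by
  have h₀ := quietSteps_rcd ls es es' i h
  change QuietSteps _ _ (.rcd ls fun j => if j < i then es' j else es j) at h₀
  set fs : Fin n → RTerm A Label := fun j => if j < i then es' j else es j with hfs
  have hv : ∀ j, j < i → IsValue ι (fs j) := fun j hj => by simpa [hfs, hj] using (h j hj).2
  obtain ⟨e', h₁, hc⟩ := hc
  have h₂ := quietSteps_rcd_update ls fs i hv h₁
  have hi : Function.update fs i (es i) = fs := by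
    conv_rhs => rw [← Function.update_eq_self i fs]
    simp [hfs]
  rw [hi] at h₂
  refine QuietSteps.trans_reaches (h₀.trans h₂) ?_
  rcases hc with rfl | hc
  · exact QuietSteps.reaches .refl
  · refine QuietSteps.trans_red .refl ?_
    have := ContextRed.rcd (S := S) (deep := deep) (cast := cast) (c := c) ls
      (Function.update fs i e') i
      (fun j hj => by rw [Function.update_of_ne hj.ne]; exact hv j hj) (by simpa using hc)
    simpa using this

/-- Values do not reduce. -/
theorem not_isValue
    (hcast : ∀ ε u o, IsRaw ι u → ¬ cast (ι ε) u o) {e : RTerm A Label} {c : Conf A Label}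
    (h : ContextRed S ι deep cast e c) : ¬ IsValue ι e := by
  induction h with
  | @cast a e o h =>
    intro hv
    obtain ⟨hu, ε, rfl⟩ := isValue_asc_inv hv
    exact hcast _ _ _ hu h
  | notion h => intro hv; have := hv.isRaw h.not_isAsc; cases this <;> cases h
  | asc hd h ih => intro hv; exact ih (.raw _ (isValue_asc_inv hv).1)
  | frame F ht h ih =>
    subst ht
    intro hv
    have := hv.isRaw (F.not_isAsc_fill _ _)
    cases F <;> cases this
  | rcd ls es i hv' h ih =>
    intro hv
    have := hv.isRaw (RTerm.not_isAsc_rcd _ _)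
    cases this with
    | rcd _ _ h' => exact ih (h' i)

end ContextRed

/-! ### Stacks of ascriptions in RL and RL⁺ -/

namespace RL

variable {Ev Label : Type*} {S : EvidenceAbstraction Ev Label}

theorem quietSteps_ascStack (εs : List Ev) {e e' : RTerm Ev Label} (h : QuietSteps (Red S) e e') :
    QuietSteps (Red S) (RTerm.ascStack εs e) (RTerm.ascStack εs e') := by
  induction εs with
  | nil => exact h
  | cons ε εs ih => exact ContextRed.quietSteps_asc ε ih fun _ => trivial

theorem reaches_ascStack (εs : List Ev) {e : RTerm Ev Label} {c : Conf Ev Label}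
    (h : Reaches (Red S) e c) :
    Reaches (Red S) (RTerm.ascStack εs e) (c.map (RTerm.ascStack εs)) := by
  induction εs with
  | nil =>
    change Reaches _ e (c.map fun e => e)
    rwa [Conf.map_id_eq]
  | cons ε εs ih =>
    have := ContextRed.reaches_asc ε ih fun _ => trivial
    rwa [Conf.map_map] at this

/-- RL merges from the inside: once the inner stack has become a single `ε₂`, the outermost evidence
composes with it or fails. If the inner total is already ⊥, the inner stack reaches `error` by
induction. -/
theorem ascStack_raw_reduces {u : RTerm Ev Label} (hu : IsRaw (id : Ev → Ev) u) (εs : List Ev) :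
    (∀ ε, S.stackTotal (εs.map some) = some (some ε) →
      QuietSteps (Red S) (RTerm.ascStack εs u) (.asc ε u)) ∧
    (S.stackTotal (εs.map some) = some none → Reaches (Red S) (RTerm.ascStack εs u) .error) := by
  induction εs with
  | nil => exact ⟨fun ε h => (by cases h), fun h => (by cases h)⟩
  | cons ε₁ εs ih =>
    rw [List.map_cons, EvidenceAbstraction.stackTotal]
    -- The inner stack is empty, or has total ⊥ (`some none`), or has total `ε₂`.
    rcases ht : S.stackTotal (εs.map some) with _ | _ | ε₂
    · rw [EvidenceAbstraction.stackTotal_eq_none, List.map_eq_nil_iff] at ht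
      subst ht
      refine ⟨fun ε h => ?_, fun h => by cases h⟩
      cases h
      exact .refl
    · refine ⟨fun ε h => (by cases h), fun _ => ?_⟩
      exact ContextRed.reaches_asc ε₁ (ih.2 ht) fun _ => trivial
    · have h₁ : QuietSteps (Red S) (RTerm.ascStack (ε₁ :: εs) u) (.asc ε₁ (.asc ε₂ u)) :=
        ContextRed.quietSteps_asc ε₁ (ih.1 ε₂ ht) fun _ => trivial
      refine ⟨fun ε h => ?_, fun h => ?_⟩
      · refine h₁.tail ⟨.cast (o := some (ε, u)) ⟨ε₂, u, rfl, hu, ?_⟩,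
          iff_of_true (RTerm.isAsc_asc _ _) (RTerm.isAsc_asc _ _)⟩
        rw [show S.comp ε₂ ε₁ = _ from Option.some_inj.1 h]
        rfl
      · refine QuietSteps.trans_red h₁ (.cast (o := none) ⟨ε₂, u, rfl, hu, ?_⟩)
        rw [show S.comp ε₂ ε₁ = _ from Option.some_inj.1 h]
        rfl

/-- RL merges only directly above a raw value, so apart from steps of the body a stack can change
only at its bottom. -/
theorem Red.ascStack_inv {εs : List Ev} {e : RTerm Ev Label} (hn : ¬ e.IsAsc) {c : Conf Ev Label}
    (h : Red S (RTerm.ascStack εs e) c) :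
    (∃ c', Red S e c' ∧ c = c'.map (RTerm.ascStack εs)) ∨
      IsRaw (id : Ev → Ev) e ∧ ∃ εs' ε₁ ε₂, εs = εs' ++ [ε₁, ε₂] ∧
        c = (Conf.ofAnnotated ((S.comp ε₂ ε₁).map (·, e))).map (RTerm.ascStack εs') := by
  induction εs generalizing c with
  | nil =>
    left
    refine ⟨c, h, ?_⟩
    exact (Conf.map_id_eq c).symm
  | cons ε εs ih =>
    generalize ht : RTerm.ascStack (ε :: εs) e = t at h
    cases h with
    | cast h =>
      cases ht
      obtain ⟨ε₂, u, hs, hu, rfl⟩ := h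
      -- Only height two fits: in a shorter stack the body would be an ascription, in a taller one
      -- the supposedly raw `u` would be.
      match εs, hs with
      | [], hs => exact absurd ⟨_, _, hs⟩ hn
      | [ε'], hs =>
        cases hs
        exact .inr ⟨hu, [], ε, ε₂, rfl, (Conf.map_id_eq _).symm⟩
      | ε' :: ε'' :: εs, hs =>
        cases hs
        exact absurd (RTerm.isAsc_asc _ _) hu.not_isAsc
    | notion h => subst ht; exact absurd (RTerm.isAsc_asc _ _) h.not_isAsc
    | asc hd h =>
      cases ht
      obtain ⟨c', hc', rfl⟩ | ⟨hu, εs', ε₁, ε₂, rfl, rfl⟩ := ih h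
      · exact .inl ⟨c', hc', by rw [Conf.map_map]; rfl⟩
      · exact .inr ⟨hu, ε :: εs', ε₁, ε₂, rfl, by rw [Conf.map_map]; rfl⟩
    | frame F ht' h => subst ht'; exact absurd ⟨_, _, ht.symm⟩ (F.not_isAsc_fill _ _)
    | rcd => cases ht

theorem Red.not_isValue {e : RTerm Ev Label} {c : Conf Ev Label} (h : Red S e c) :
    ¬ IsValue (id : Ev → Ev) e :=
  ContextRed.not_isValue (by
    rintro ε _ o hu ⟨ε₂, u, rfl, -⟩
    exact hu.not_isAsc (RTerm.isAsc_asc _ _)) h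

end RL

namespace RLPlus

variable {Ev Label : Type*} {S : EvidenceAbstraction Ev Label}

/-- Nothing is asked of the body: RL⁺ merges from the outside, and an undefined composition becomes
⊥ instead of stopping the merge. -/
theorem quietSteps_ascStack (hassoc : S.CompAssoc) {bs : List (Option Ev)} {b : Option Ev}
    (h : S.stackTotal bs = some b) (e : RTerm (Option Ev) Label) :
    QuietSteps (Red S) (RTerm.ascStack bs e) (.asc b e) := by
  cases bs with
  | nil => cases h
  | cons b₁ bs =>
    induction bs generalizing b₁ with
    | nil => cases h; exact .refl
    | cons b₂ bs ih =>
      rw [EvidenceAbstraction.stackTotal_cons_cons hassoc] at h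
      refine .head ⟨.cast (o := some _) (.inl ⟨_, _, rfl, rfl⟩),
        iff_of_true (RTerm.isAsc_asc _ _) (RTerm.isAsc_asc _ _)⟩ (ih _ h)

/-- RL⁺ does not reduce under two adjacent ascriptions, so the body can move, or a latent failure
surface, only at height one; a taller stack must merge at its top. -/
theorem Red.ascStack_inv {b : Option Ev} {bs : List (Option Ev)} {e : RTerm (Option Ev) Label}
    (hn : ¬ e.IsAsc) {c : Conf (Option Ev) Label}
    (h : Red S (RTerm.ascStack (b :: bs) e) c) :
    (bs = [] ∧ ∃ c', Red S e c' ∧ c = c'.map (RTerm.asc b)) ∨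
      (bs = [] ∧ b = none ∧ IsRaw (some : Ev → Option Ev) e ∧ c = .error) ∨
      ∃ b' bs', bs = b' :: bs' ∧ c = .term (RTerm.ascStack (S.totalComp b' b :: bs') e) := by
  generalize ht : RTerm.ascStack (b :: bs) e = t at h
  cases h with
  | cast h =>
    cases ht
    obtain ⟨b₂, e', hs, rfl⟩ | ⟨rfl, hu, rfl⟩ := h
    · cases bs with
      | nil => exact absurd ⟨_, _, hs⟩ hn
      | cons b' bs => cases hs; exact .inr (.inr ⟨_, _, rfl, rfl⟩)
    · cases bs with
      | nil => exact .inr (.inl ⟨rfl, rfl, hu, rfl⟩)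
      | cons b' bs => exact absurd (RTerm.isAsc_asc _ _) hu.not_isAsc
  | notion h => subst ht; exact absurd (RTerm.isAsc_asc _ _) h.not_isAsc
  | asc hd h =>
    cases ht
    cases bs with
    | nil => exact .inl ⟨rfl, _, h, rfl⟩
    | cons b' bs => exact (hd (RTerm.isAsc_asc _ _)).elim
  | frame F ht' h => subst ht'; exact absurd ⟨_, _, ht.symm⟩ (F.not_isAsc_fill _ _)
  | rcd => cases ht

theorem Red.not_isValue {e : RTerm (Option Ev) Label} {c : Conf (Option Ev) Label}
    (h : Red S e c) : ¬ IsValue (some : Ev → Option Ev) e :=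
  ContextRed.not_isValue (by
    rintro ε _ o hu (⟨ε₂, u, rfl, -⟩ | ⟨h, -⟩)
    · exact hu.not_isAsc (RTerm.isAsc_asc _ _)
    · cases h) h

end RLPlus

/-! ### Values related by `≈` -/

section Values

variable {Ev Label : Type*} {S : EvidenceAbstraction Ev Label}

/-- A stack of ascriptions on a term other than an ascription is a value only if it has height one
and the term is raw. -/
theorem isValue_ascStack_cons {A : Type*} {ι : Ev → A} {a : A} {as : List A} {e : RTerm A Label}
    (h : IsValue ι (RTerm.ascStack (a :: as) e)) : as = [] ∧ IsRaw ι e ∧ ∃ ε, a = ι ε := by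
  obtain ⟨hu, hε⟩ := isValue_asc_inv (a := a) (e := RTerm.ascStack as e) h
  cases as with
  | nil => exact ⟨rfl, hu, hε⟩
  | cons a' as => exact absurd (RTerm.isAsc_asc _ _) hu.not_isAsc

/-- An ascribed value has a stack of height one, so the total on the RL⁺ side is ordinary evidence.
RL⁺ merges its stack first and then evaluates the body under the one remaining ascription. -/
theorem Sim.quietSteps_of_isValue_left (hassoc : S.CompAssoc) {e₁ : RTerm Ev Label}
    {e₂ : RTerm (Option Ev) Label} (h : Sim S e₁ e₂) (hv : IsValue (id : Ev → Ev) e₁) :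
    QuietSteps (RLPlus.Red S) e₂ (e₁.mapEv some) := by
  induction h with
  | casts ε εs b bs e₁ e₂ h₁ h₂ h heq ih =>
    obtain ⟨rfl, hu, -⟩ := isValue_ascStack_cons hv
    have ht : S.stackTotal (b :: bs) = some (some ε) := by
      rw [EvidenceAbstraction.stackTotal_cons_eq_leftTotal, ← heq]
      rfl
    exact (RLPlus.quietSteps_ascStack hassoc ht e₂).trans
      (ContextRed.quietSteps_asc _ (ih (.raw _ hu)) fun h => absurd h h₂)
  | raw u hu => exact .refl
  | rcd ls es es' h ih =>
    have hv' : ∀ i, IsValue (id : Ev → Ev) (es i) := by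
      cases hv.isRaw (RTerm.not_isAsc_rcd _ _) with
      | rcd _ _ h => exact h
    rename_i n
    have := ContextRed.quietSteps_rcd (S := S) (ι := some) (deep := False)
      (cast := RLPlus.CastRule S) ls es' (fun i => (es i).mapEv some) n
      (fun i _ => ⟨ih i (hv' i), (hv' i).mapEv⟩)
    simpa [RTerm.mapEv] using this
  | _ => exact nomatch hv.isRaw (by rintro ⟨_, _, h⟩; cases h)

/-- The order is opposite to that in RL⁺: RL evaluates the body under the whole stack first, because
it merges only over a raw value. -/
theorem Sim.quietSteps_of_isValue_right (hassoc : S.CompAssoc) {e₁ : RTerm Ev Label}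
    {e₂ : RTerm (Option Ev) Label} (h : Sim S e₁ e₂)
    (hv : IsValue (some : Ev → Option Ev) e₂) :
    ∃ v, QuietSteps (RL.Red S) e₁ v ∧ IsValue (id : Ev → Ev) v ∧ v.mapEv some = e₂ := by
  induction h with
  | casts ε εs b bs e₁ e₂ h₁ h₂ h heq ih =>
    obtain ⟨rfl, hu, ε', rfl⟩ := isValue_ascStack_cons hv
    obtain ⟨v, hs, hv', rfl⟩ := ih (.raw _ hu)
    have hu' := hv'.isRaw (RTerm.isAsc_mapEv.not.1 h₂)
    have ht : S.stackTotal ((ε :: εs).map some) = some (some ε') := by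
      rw [List.map_cons, EvidenceAbstraction.stackTotal_cons_eq_rightTotal hassoc, heq]
      rfl
    exact ⟨.asc ε' v, (RL.quietSteps_ascStack (ε :: εs) hs).trans
      ((RL.ascStack_raw_reduces hu' (ε :: εs)).1 ε' ht), .asc ε' v hu', rfl⟩
  | raw u hu => exact ⟨u, .refl, .raw _ hu, rfl⟩
  | rcd ls es es' h ih =>
    have hv' : ∀ i, IsValue (some : Ev → Option Ev) (es' i) := by
      cases hv.isRaw (RTerm.not_isAsc_rcd _ _) with
      | rcd _ _ h => exact h
    choose vs hs hvs hes using fun i => ih i (hv' i)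
    rename_i n
    have := ContextRed.quietSteps_rcd (S := S) (ι := id) (deep := True)
      (cast := RL.CastRule S) ls es vs n (fun i _ => ⟨hs i, hvs i⟩)
    exact ⟨.rcd ls vs, by simpa using this, .raw _ (.rcd _ _ hvs), by simp [RTerm.mapEv, hes]⟩
  | _ => exact nomatch hv.isRaw (by rintro ⟨_, _, h⟩; cases h)

theorem Sim.quietSteps_asc_left (hassoc : S.CompAssoc) {ε : Ev} {u : RTerm Ev Label}
    {b : Option Ev} {e : RTerm (Option Ev) Label} (h : Sim S (.asc ε u) (.asc b e))
    (hu : IsRaw (id : Ev → Ev) u) :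
    QuietSteps (RLPlus.Red S) (.asc b e) (.asc (some ε) (u.mapEv some)) :=
  h.quietSteps_of_isValue_left hassoc (.asc ε u hu)

theorem Sim.quietSteps_asc_right (hassoc : S.CompAssoc) {ε : Ev} {e : RTerm Ev Label}
    {ε' : Ev} {u : RTerm (Option Ev) Label} (h : Sim S (.asc ε e) (.asc (some ε') u))
    (hu : IsRaw (some : Ev → Option Ev) u) :
    ∃ u', QuietSteps (RL.Red S) (.asc ε e) (.asc ε' u') ∧ IsRaw (id : Ev → Ev) u' ∧
      u'.mapEv some = u := by
  obtain ⟨v, hs, hv, hm⟩ := h.quietSteps_of_isValue_right hassoc (.asc ε' u hu)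
  obtain ⟨ε'', u', rfl, he, rfl⟩ := RTerm.mapEv_eq_asc hm
  cases he
  exact ⟨u', hs, (isValue_asc_inv hv).1, rfl⟩

end Values

/-! ### Inversion of structural reduction -/

namespace ContextRed

variable {Ev A Label : Type*} {S : EvidenceAbstraction Ev Label} {ι : Ev → A} {deep : Prop}
  {cast : A → RTerm A Label → Option (A × RTerm A Label) → Prop}

theorem app_inv {a₁ a₂ : A} {e₁ e₂ : RTerm A Label} {c : Conf A Label}
    (h : ContextRed S ι deep cast (.app a₁ e₁ a₂ e₂) c) :
    Notion S ι (.app a₁ e₁ a₂ e₂) c ∨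
      (∃ c', ContextRed S ι deep cast (.asc a₁ e₁) c' ∧
        c = c'.mapAsc fun a e => .app a e a₂ e₂) ∨
      ∃ ε c', a₁ = ι ε ∧ IsRaw ι e₁ ∧ ContextRed S ι deep cast (.asc a₂ e₂) c' ∧
        c = c'.mapAsc fun a e => .app a₁ e₁ a e := by
  generalize ht : RTerm.app a₁ e₁ a₂ e₂ = t at h
  cases h with
  | notion h => exact .inl h
  | frame F ht' h =>
    subst ht'
    cases F <;> cases ht
    · exact .inr (.inl ⟨_, h, rfl⟩)
    · exact .inr (.inr ⟨_, _, rfl, ‹_›, h, rfl⟩)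
  | _ => cases ht

theorem plus_inv {a₁ a₂ : A} {e₁ e₂ : RTerm A Label} {c : Conf A Label}
    (h : ContextRed S ι deep cast (.plus a₁ e₁ a₂ e₂) c) :
    Notion S ι (.plus a₁ e₁ a₂ e₂) c ∨
      (∃ c', ContextRed S ι deep cast (.asc a₁ e₁) c' ∧
        c = c'.mapAsc fun a e => .plus a e a₂ e₂) ∨
      ∃ ε c', a₁ = ι ε ∧ IsRaw ι e₁ ∧ ContextRed S ι deep cast (.asc a₂ e₂) c' ∧
        c = c'.mapAsc fun a e => .plus a₁ e₁ a e := by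
  generalize ht : RTerm.plus a₁ e₁ a₂ e₂ = t at h
  cases h with
  | notion h => exact .inl h
  | frame F ht' h =>
    subst ht'
    cases F <;> cases ht
    · exact .inr (.inl ⟨_, h, rfl⟩)
    · exact .inr (.inr ⟨_, _, rfl, ‹_›, h, rfl⟩)
  | _ => cases ht

theorem ite_inv {a₁ a₂ a₃ : A} {e₁ e₂ e₃ : RTerm A Label} {c : Conf A Label}
    (h : ContextRed S ι deep cast (.ite a₁ e₁ a₂ e₂ a₃ e₃) c) :
    Notion S ι (.ite a₁ e₁ a₂ e₂ a₃ e₃) c ∨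
      ∃ c', ContextRed S ι deep cast (.asc a₁ e₁) c' ∧
        c = c'.mapAsc fun a e => .ite a e a₂ e₂ a₃ e₃ := by
  generalize ht : RTerm.ite a₁ e₁ a₂ e₂ a₃ e₃ = t at h
  cases h with
  | notion h => exact .inl h
  | frame F ht' h =>
    subst ht'
    cases F <;> cases ht
    exact .inr ⟨_, h, rfl⟩
  | _ => cases ht

theorem proj_inv {a : A} {e : RTerm A Label} {l : Label} {c : Conf A Label}
    (h : ContextRed S ι deep cast (.proj a e l) c) :
    Notion S ι (.proj a e l) c ∨
      ∃ c', ContextRed S ι deep cast (.asc a e) c' ∧ c = c'.mapAsc fun a e => .proj a e l := by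
  generalize ht : RTerm.proj a e l = t at h
  cases h with
  | notion h => exact .inl h
  | frame F ht' h =>
    subst ht'
    cases F <;> cases ht
    exact .inr ⟨_, h, rfl⟩
  | _ => cases ht

theorem rcd_inv {n : ℕ} {ls : Fin n ↪ Label} {es : Fin n → RTerm A Label} {c : Conf A Label}
    (h : ContextRed S ι deep cast (.rcd ls es) c) :
    ∃ i c', (∀ j, j < i → IsValue ι (es j)) ∧ ContextRed S ι deep cast (es i) c' ∧
      c = c'.map fun e => .rcd ls (Function.update es i e) := by
  generalize ht : RTerm.rcd ls es = t at h
  cases h with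
  | notion h => subst ht; cases h
  | frame F ht' h => subst ht'; cases F <;> cases ht
  | rcd ls es i hv h => cases ht; exact ⟨i, _, hv, h, rfl⟩
  | _ => cases ht

end ContextRed

namespace SimConf

variable {Ev Label : Type*} {S : EvidenceAbstraction Ev Label}

theorem mapAsc {c₁ : Conf Ev Label} {c₂ : Conf (Option Ev) Label} (h : SimConf S c₁ c₂)
    (h₁ : c₁.AscOrError) (h₂ : c₂.AscOrError) {K₁ : Ev → RTerm Ev Label → RTerm Ev Label}
    {K₂ : Option Ev → RTerm (Option Ev) Label → RTerm (Option Ev) Label}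
    (hK : ∀ ε e b e', Sim S (.asc ε e) (.asc b e') → Sim S (K₁ ε e) (K₂ b e')) :
    SimConf S (c₁.mapAsc K₁) (c₂.mapAsc K₂) := by
  cases h with
  | error => exact .error
  | term e₁ e₂ h =>
    cases h₁
    cases h₂
    exact .term _ _ (hK _ _ _ _ h)

theorem map {c₁ : Conf Ev Label} {c₂ : Conf (Option Ev) Label} (h : SimConf S c₁ c₂)
    {f₁ : RTerm Ev Label → RTerm Ev Label}
    {f₂ : RTerm (Option Ev) Label → RTerm (Option Ev) Label}
    (hf : ∀ e e', Sim S e e' → Sim S (f₁ e) (f₂ e')) :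
    SimConf S (c₁.map f₁) (c₂.map f₂) := by
  cases h with
  | error => exact .error
  | term e₁ e₂ h => exact .term _ _ (hf _ _ h)

end SimConf

/-! ### The two simulations -/

namespace Sim

variable {Ev Label : Type*} {S : EvidenceAbstraction Ev Label}

theorem rcd_update {n : ℕ} (ls : Fin n ↪ Label) {es : Fin n → RTerm Ev Label}
    {es' : Fin n → RTerm (Option Ev) Label} (i : Fin n) (h : ∀ j, j ≠ i → Sim S (es j) (es' j))
    {e : RTerm Ev Label} {e' : RTerm (Option Ev) Label} (he : Sim S e e') :
    Sim S (.rcd ls (Function.update es i e)) (.rcd ls (Function.update es' i e')) := by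
  refine .rcd _ _ _ fun j => ?_
  by_cases hj : j = i
  · subst hj; simpa using he
  · simpa [hj] using h j hj

/-- Every step of RL is matched in RL⁺. -/
theorem forward (hassoc : S.CompAssoc) {e₁ : RTerm Ev Label} {e₂ : RTerm (Option Ev) Label}
    (h : Sim S e₁ e₂) {c₁ : Conf Ev Label} (hr : RL.Red S e₁ c₁) :
    ∃ c₂, Reaches (RLPlus.Red S) e₂ c₂ ∧ SimConf S c₁ c₂ := by
  induction h generalizing c₁ with
  | casts ε εs b bs e₁ e₂ h₁ h₂ h heq ih =>
    replace heq : S.stackTotal ((ε :: εs).map some) = S.stackTotal (b :: bs) := by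
      rw [List.map_cons, EvidenceAbstraction.stackTotal_cons_eq_rightTotal hassoc, heq,
        EvidenceAbstraction.stackTotal_cons_eq_leftTotal]
    obtain ⟨b', hb'⟩ : ∃ b', S.stackTotal (b :: bs) = some b' :=
      ⟨_, EvidenceAbstraction.stackTotal_cons_eq_leftTotal _ _⟩
    -- RL⁺ can collapse its stack to the common total before the body is touched.
    have hmerge := RLPlus.quietSteps_ascStack hassoc hb' e₂
    obtain ⟨c, hc, rfl⟩ | ⟨hu, εs', ε₁, ε₂, hε, rfl⟩ := hr.ascStack_inv h₁
    · obtain ⟨c₂, hc₂, hs⟩ := ih hc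
      refine ⟨_, hmerge.trans_reaches (ContextRed.reaches_asc b' hc₂ fun h => absurd h h₂),
        hs.map fun e e' h => h.ascStack hassoc (bs := [b']) ?_⟩
      rw [heq, hb']
      rfl
    · rw [hε, List.map_append] at heq
      replace heq := (EvidenceAbstraction.stackTotal_append_pair hassoc _ _ _).symm.trans heq
      cases hcomp : S.comp ε₂ ε₁ with
      | some ε' =>
        -- The merge in RL leaves the total unchanged, so RL⁺ need not move.
        refine ⟨_, QuietSteps.reaches .refl, .term _ _ ?_⟩
        change Sim S (RTerm.ascStack εs' (RTerm.ascStack [ε'] e₁)) _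
        rw [← RTerm.ascStack_append]
        refine h.ascStack hassoc ?_
        rw [← heq, List.map_append, EvidenceAbstraction.totalComp, hcomp]
        rfl
      | none =>
        refine ⟨.error, ?_, .error⟩
        -- The failed composition sits at the bottom of the stack, and ⊥ absorbs whatever lies
        -- outside it.
        have hnone : b' = none := by
          have h0 : S.totalComp (some ε₂) (some ε₁) = none := hcomp
          rw [h0, EvidenceAbstraction.stackTotal_append hassoc, hb'] at heq
          cases ht : S.stackTotal (εs'.map some) with
          | none => rw [ht] at heq; cases heq; rfl
          | some b'' =>
            rw [ht] at heq
            change some (S.totalComp none b'') = _ at heq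
            rw [EvidenceAbstraction.totalComp_none_left] at heq
            exact (Option.some_inj.1 heq).symm
        subst hnone
        -- RL⁺ merges to ⊥, brings its body to the raw value, and only then fails.
        refine QuietSteps.trans_red (hmerge.trans (ContextRed.quietSteps_asc none
          (h.quietSteps_of_isValue_left hassoc (.raw _ hu)) fun h => absurd h h₂))
          (.cast (o := none) (.inr ⟨rfl, hu.mapEv, rfl⟩))
  | raw u hu => exact absurd (.raw _ hu) hr.not_isValue
  | app ε₁ ε₂ b₃ b₄ e₁ e₂ e₃ e₄ h₁ h₂ ih₁ ih₂ =>
    have left : IsRaw (id : Ev → Ev) e₁ → QuietSteps (RLPlus.Red S) (.app b₃ e₃ b₄ e₄)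
        (.app (some ε₁) (e₁.mapEv some) b₄ e₄) := fun hu =>
      ContextRed.quietSteps_fill (.appL b₄ e₄) (h₁.quietSteps_asc_left hassoc hu)
    have right : ∀ hu : IsRaw (id : Ev → Ev) e₁, IsRaw (id : Ev → Ev) e₂ →
        QuietSteps (RLPlus.Red S) (.app b₃ e₃ b₄ e₄)
        (.app (some ε₁) (e₁.mapEv some) (some ε₂) (e₂.mapEv some)) := fun hu hu' =>
      (left hu).trans
        (ContextRed.quietSteps_fill (.appR ε₁ _ hu.mapEv) (h₂.quietSteps_asc_left hassoc hu'))
    obtain hr | ⟨c, hc, rfl⟩ | ⟨ε, c, -, hu, hc, rfl⟩ := hr.app_inv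
    · cases hr with
      | beta ε₁ ε₂ ε₃ e _ hf hu hε =>
        refine ⟨_, QuietSteps.trans_red (right (.lam e) hu)
          (.notion (.beta ε₁ ε₂ ε₃ _ _ hf hu.mapEv hε)), .term _ _ ?_⟩
        -- `mapEv` commutes with `inst`, so the RL⁺ contractum is the image of the RL contractum.
        have := Sim.refl hassoc (S := S)
          (RTerm.asc (S.icod ⟨ε₁, hf⟩) (RTerm.inst (.asc ε₃ e₂) e))
        rwa [RTerm.mapEv, RTerm.mapEv_inst, RTerm.mapEv] at this
      | betaError ε₁ ε₂ e _ hf hu hε =>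
        exact ⟨_, QuietSteps.trans_red (right (.lam e) hu)
          (.notion (.betaError ε₁ ε₂ _ _ hf hu.mapEv hε)), .error⟩
    · obtain ⟨c₂, hc₂, hs⟩ := ih₁ hc
      exact ⟨_, ContextRed.reaches_fill (.appL b₄ e₄) hc₂,
        hs.mapAsc hc.ascOrError (ContextRed.reaches_ascOrError hc₂)
          fun _ _ _ _ h => .app _ _ _ _ _ _ _ _ h h₂⟩
    · obtain ⟨c₂, hc₂, hs⟩ := ih₂ hc
      -- RL⁺ must finish its left operand before entering the right one. That operand is then an
      -- image, so `Sim.refl` relates it in place of `h₁`.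
      exact ⟨_, (left hu).trans_reaches (ContextRed.reaches_fill (.appR ε₁ _ hu.mapEv) hc₂),
        hs.mapAsc hc.ascOrError (ContextRed.reaches_ascOrError hc₂)
          fun _ _ _ _ h => .app _ _ _ _ _ _ _ _ (Sim.refl hassoc (.asc ε₁ e₁)) h⟩
  | plus ε₁ ε₂ b₃ b₄ e₁ e₂ e₃ e₄ h₁ h₂ ih₁ ih₂ =>
    have left : IsRaw (id : Ev → Ev) e₁ → QuietSteps (RLPlus.Red S) (.plus b₃ e₃ b₄ e₄)
        (.plus (some ε₁) (e₁.mapEv some) b₄ e₄) := fun hu =>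
      ContextRed.quietSteps_fill (.plusL b₄ e₄) (h₁.quietSteps_asc_left hassoc hu)
    obtain hr | ⟨c, hc, rfl⟩ | ⟨ε, c, -, hu, hc, rfl⟩ := hr.plus_inv
    · cases hr with
      | plus ε₁ ε₂ n₁ n₂ =>
        exact ⟨_, QuietSteps.trans_red ((left (.int n₁)).trans (ContextRed.quietSteps_fill
          (.plusR ε₁ (.int n₁) (.int n₁)) (h₂.quietSteps_asc_left hassoc (.int n₂))))
          (.notion (.plus ε₁ ε₂ n₁ n₂)), .term _ _ (Sim.refl hassoc (.int (n₁ + n₂)))⟩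
    · obtain ⟨c₂, hc₂, hs⟩ := ih₁ hc
      exact ⟨_, ContextRed.reaches_fill (.plusL b₄ e₄) hc₂,
        hs.mapAsc hc.ascOrError (ContextRed.reaches_ascOrError hc₂)
          fun _ _ _ _ h => .plus _ _ _ _ _ _ _ _ h h₂⟩
    · obtain ⟨c₂, hc₂, hs⟩ := ih₂ hc
      exact ⟨_, (left hu).trans_reaches (ContextRed.reaches_fill (.plusR ε₁ _ hu.mapEv) hc₂),
        hs.mapAsc hc.ascOrError (ContextRed.reaches_ascOrError hc₂)
          fun _ _ _ _ h => .plus _ _ _ _ _ _ _ _ (Sim.refl hassoc (.asc ε₁ e₁)) h⟩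
  | ite ε₁ ε₂ ε₃ b₄ b₅ b₆ e₁ e₂ e₃ e₄ e₅ e₆ h₁ h₂ h₃ ih₁ ih₂ ih₃ =>
    obtain hr | ⟨c, hc, rfl⟩ := hr.ite_inv
    · cases hr with
      | iteTrue ε₁ =>
        exact ⟨_, QuietSteps.trans_red (ContextRed.quietSteps_fill (.ite b₅ e₅ b₆ e₆)
          (h₁.quietSteps_asc_left hassoc (.bool true))) (.notion (.iteTrue ε₁ _ _ _ _)),
          .term _ _ h₂⟩
      | iteFalse ε₁ =>
        exact ⟨_, QuietSteps.trans_red (ContextRed.quietSteps_fill (.ite b₅ e₅ b₆ e₆)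
          (h₁.quietSteps_asc_left hassoc (.bool false))) (.notion (.iteFalse ε₁ _ _ _ _)),
          .term _ _ h₃⟩
    · obtain ⟨c₂, hc₂, hs⟩ := ih₁ hc
      exact ⟨_, ContextRed.reaches_fill (.ite b₅ e₅ b₆ e₆) hc₂,
        hs.mapAsc hc.ascOrError (ContextRed.reaches_ascOrError hc₂)
          fun _ _ _ _ h => .ite _ _ _ _ _ _ _ _ _ _ _ _ h h₂ h₃⟩
  | proj ε b e e' l h ih =>
    obtain hr | ⟨c, hc, rfl⟩ := hr.proj_inv
    · cases hr with
      | proj ε ls es j hv hd =>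
        exact ⟨_, QuietSteps.trans_red (ContextRed.quietSteps_fill (.proj (ls j))
          (h.quietSteps_asc_left hassoc (.rcd ls es hv)))
          (.notion (.proj ε ls _ j (fun i => (hv i).mapEv) hd)),
          .term _ _ (Sim.refl hassoc (.asc _ (es j)))⟩
    · obtain ⟨c₂, hc₂, hs⟩ := ih hc
      exact ⟨_, ContextRed.reaches_fill (.proj l) hc₂,
        hs.mapAsc hc.ascOrError (ContextRed.reaches_ascOrError hc₂)
          fun _ _ _ _ h => .proj _ _ _ _ _ h⟩
  | rcd ls es es' h ih =>
    obtain ⟨i, c, hv, hc, rfl⟩ := hr.rcd_inv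
    obtain ⟨c₂, hc₂, hs⟩ := ih i hc
    refine ⟨_, ContextRed.reaches_rcd ls es' (fun j => (es j).mapEv some) i
      (fun j hj => ⟨(h j).quietSteps_of_isValue_left hassoc (hv j hj), (hv j hj).mapEv⟩) hc₂,
      hs.map fun e e' he => Sim.rcd_update ls i (fun j _ => ?_) he⟩
    -- Fields before `i` have become images of values; fields after `i` are untouched.
    by_cases hj : j < i
    · simpa [hj] using Sim.refl hassoc (es j)
    · simpa [hj] using h j

/-- Every step of RL⁺ is matched in RL. -/
theorem backward (hassoc : S.CompAssoc) {e₁ : RTerm Ev Label} {e₂ : RTerm (Option Ev) Label}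
    (h : Sim S e₁ e₂) {c₂ : Conf (Option Ev) Label} (hr : RLPlus.Red S e₂ c₂) :
    ∃ c₁, Reaches (RL.Red S) e₁ c₁ ∧ SimConf S c₁ c₂ := by
  induction h generalizing c₂ with
  | casts ε εs b bs e₁ e₂ h₁ h₂ h heq ih =>
    replace heq : S.stackTotal ((ε :: εs).map some) = S.stackTotal (b :: bs) := by
      rw [List.map_cons, EvidenceAbstraction.stackTotal_cons_eq_rightTotal hassoc, heq,
        EvidenceAbstraction.stackTotal_cons_eq_leftTotal]
    obtain ⟨rfl, c, hc, rfl⟩ | ⟨rfl, rfl, hu, rfl⟩ | ⟨b', bs', rfl, rfl⟩ := hr.ascStack_inv h₂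
    -- RL reduces under nested ascriptions, so it can follow the body without merging its own stack.
    · obtain ⟨c₁, hc₁, hs⟩ := ih hc
      exact ⟨_, RL.reaches_ascStack (ε :: εs) hc₁,
        hs.map fun e e' h => h.ascStack hassoc (bs := [b]) heq⟩
    -- The total on the RL side is ⊥ as well, so merging over the evaluated body must meet an
    -- undefined composition.
    · obtain ⟨v, hs, hv, rfl⟩ := h.quietSteps_of_isValue_right hassoc (.raw _ hu)
      have hv' := hv.isRaw (RTerm.isAsc_mapEv.not.1 h₂)
      exact ⟨.error, (RL.quietSteps_ascStack (ε :: εs) hs).trans_reaches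
        ((RL.ascStack_raw_reduces hv' (ε :: εs)).2 heq), .error⟩
    · refine ⟨_, QuietSteps.reaches .refl, .term _ _ (h.ascStack hassoc ?_)⟩
      rw [heq, EvidenceAbstraction.stackTotal_cons_cons hassoc]
  | raw u hu => exact absurd (.raw _ hu.mapEv) hr.not_isValue
  | app ε₁ ε₂ b₃ b₄ e₁ e₂ e₃ e₄ h₁ h₂ ih₁ ih₂ =>
    obtain hr | ⟨c, hc, rfl⟩ | ⟨ε, c, rfl, hu, hc, rfl⟩ := hr.app_inv
    -- Both β-rules need the same preparation: RL evaluates its two operands to preimages of those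
    -- on the RL⁺ side.
    · have key : ∀ (ε₃ ε₄ : Ev) (e : RTerm (Option Ev) Label), b₃ = some ε₃ → b₄ = some ε₄ →
          e₃ = .lam e → IsRaw (some : Ev → Option Ev) e₄ → ∃ e' u,
            QuietSteps (RL.Red S) (.app ε₁ e₁ ε₂ e₂) (.app ε₃ (.lam e') ε₄ u) ∧
            IsRaw (id : Ev → Ev) u ∧ e'.mapEv some = e ∧ u.mapEv some = e₄ := by
        rintro ε₃ ε₄ e rfl rfl rfl hu
        obtain ⟨f, hf, hfu, hfe⟩ := h₁.quietSteps_asc_right hassoc (.lam e)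
        obtain ⟨e', rfl, rfl⟩ := RTerm.mapEv_eq_lam hfe
        obtain ⟨u, hs, hu', rfl⟩ := h₂.quietSteps_asc_right hassoc hu
        exact ⟨e', u, (ContextRed.quietSteps_fill (.appL ε₂ e₂) hf).trans
          (ContextRed.quietSteps_fill (.appR ε₃ _ hfu) hs), hu', rfl, rfl⟩
      cases hr with
      | beta ε₃ ε₄ ε₅ e _ hf hu hε =>
        obtain ⟨e', u, hs, hu', rfl, rfl⟩ := key _ _ _ rfl rfl rfl hu
        refine ⟨_, QuietSteps.trans_red hs (.notion (.beta ε₃ ε₄ ε₅ _ _ hf hu' hε)), .term _ _ ?_⟩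
        have := Sim.refl hassoc (S := S)
          (RTerm.asc (S.icod ⟨ε₃, hf⟩) (RTerm.inst (.asc ε₅ u) e'))
        rwa [RTerm.mapEv, RTerm.mapEv_inst, RTerm.mapEv] at this
      | betaError ε₃ ε₄ e _ hf hu hε =>
        obtain ⟨e', u, hs, hu', rfl, rfl⟩ := key _ _ _ rfl rfl rfl hu
        exact ⟨_, QuietSteps.trans_red hs (.notion (.betaError ε₃ ε₄ _ _ hf hu' hε)), .error⟩
    · obtain ⟨c₁, hc₁, hs⟩ := ih₁ hc
      exact ⟨_, ContextRed.reaches_fill (.appL ε₂ e₂) hc₁,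
        hs.mapAsc (ContextRed.reaches_ascOrError hc₁) hc.ascOrError
          fun _ _ _ _ h => .app _ _ _ _ _ _ _ _ h h₂⟩
    · obtain ⟨c₁, hc₁, hs⟩ := ih₂ hc
      obtain ⟨u, hq, hu', rfl⟩ := h₁.quietSteps_asc_right hassoc hu
      exact ⟨_, QuietSteps.trans_reaches (ContextRed.quietSteps_fill (.appL ε₂ e₂) hq)
          (ContextRed.reaches_fill (.appR ε u hu') hc₁),
        hs.mapAsc (ContextRed.reaches_ascOrError hc₁) hc.ascOrError
          fun _ _ _ _ h => .app _ _ _ _ _ _ _ _ (Sim.refl hassoc (.asc ε u)) h⟩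
  | plus ε₁ ε₂ b₃ b₄ e₁ e₂ e₃ e₄ h₁ h₂ ih₁ ih₂ =>
    obtain hr | ⟨c, hc, rfl⟩ | ⟨ε, c, rfl, hu, hc, rfl⟩ := hr.plus_inv
    · cases hr with
      | plus ε₃ ε₄ n₁ n₂ =>
        obtain ⟨u₁, hs₁, hu₁, he₁⟩ := h₁.quietSteps_asc_right hassoc (.int n₁)
        obtain ⟨u₂, hs₂, hu₂, he₂⟩ := h₂.quietSteps_asc_right hassoc (.int n₂)
        obtain rfl := RTerm.mapEv_eq_int he₁
        obtain rfl := RTerm.mapEv_eq_int he₂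
        exact ⟨_, QuietSteps.trans_red ((ContextRed.quietSteps_fill (.plusL ε₂ e₂) hs₁).trans
          (ContextRed.quietSteps_fill (.plusR ε₃ _ hu₁) hs₂)) (.notion (.plus ε₃ ε₄ n₁ n₂)),
          .term _ _ (Sim.refl hassoc (.int (n₁ + n₂)))⟩
    · obtain ⟨c₁, hc₁, hs⟩ := ih₁ hc
      exact ⟨_, ContextRed.reaches_fill (.plusL ε₂ e₂) hc₁,
        hs.mapAsc (ContextRed.reaches_ascOrError hc₁) hc.ascOrError
          fun _ _ _ _ h => .plus _ _ _ _ _ _ _ _ h h₂⟩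
    · obtain ⟨c₁, hc₁, hs⟩ := ih₂ hc
      obtain ⟨u, hq, hu', rfl⟩ := h₁.quietSteps_asc_right hassoc hu
      exact ⟨_, QuietSteps.trans_reaches (ContextRed.quietSteps_fill (.plusL ε₂ e₂) hq)
          (ContextRed.reaches_fill (.plusR ε u hu') hc₁),
        hs.mapAsc (ContextRed.reaches_ascOrError hc₁) hc.ascOrError
          fun _ _ _ _ h => .plus _ _ _ _ _ _ _ _ (Sim.refl hassoc (.asc ε u)) h⟩
  | ite ε₁ ε₂ ε₃ b₄ b₅ b₆ e₁ e₂ e₃ e₄ e₅ e₆ h₁ h₂ h₃ ih₁ ih₂ ih₃ =>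
    obtain hr | ⟨c, hc, rfl⟩ := hr.ite_inv
    · cases hr with
      | iteTrue ε =>
        obtain ⟨u, hs, -, he⟩ := h₁.quietSteps_asc_right hassoc (.bool true)
        obtain rfl := RTerm.mapEv_eq_bool he
        exact ⟨_, QuietSteps.trans_red (ContextRed.quietSteps_fill (.ite ε₂ e₂ ε₃ e₃) hs)
          (.notion (.iteTrue ε _ _ _ _)), .term _ _ h₂⟩
      | iteFalse ε =>
        obtain ⟨u, hs, -, he⟩ := h₁.quietSteps_asc_right hassoc (.bool false)
        obtain rfl := RTerm.mapEv_eq_bool he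
        exact ⟨_, QuietSteps.trans_red (ContextRed.quietSteps_fill (.ite ε₂ e₂ ε₃ e₃) hs)
          (.notion (.iteFalse ε _ _ _ _)), .term _ _ h₃⟩
    · obtain ⟨c₁, hc₁, hs⟩ := ih₁ hc
      exact ⟨_, ContextRed.reaches_fill (.ite ε₂ e₂ ε₃ e₃) hc₁,
        hs.mapAsc (ContextRed.reaches_ascOrError hc₁) hc.ascOrError
          fun _ _ _ _ h => .ite _ _ _ _ _ _ _ _ _ _ _ _ h h₂ h₃⟩
  | proj ε b e e' l h ih =>
    obtain hr | ⟨c, hc, rfl⟩ := hr.proj_inv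
    · cases hr with
      | proj ε' ls es' j hv hd =>
        obtain ⟨u, hs, hu, he⟩ := h.quietSteps_asc_right hassoc (.rcd ls es' hv)
        obtain ⟨es, rfl, hes⟩ := RTerm.mapEv_eq_rcd he
        have hv' : ∀ i, IsValue (id : Ev → Ev) (es i) := by
          cases hu with
          | rcd _ _ h => exact h
        refine ⟨_, QuietSteps.trans_red (ContextRed.quietSteps_fill (.proj (ls j)) hs)
          (.notion (.proj ε' ls es j hv' hd)), .term _ _ ?_⟩
        rw [← hes]
        exact Sim.refl hassoc (.asc _ (es j))
    · obtain ⟨c₁, hc₁, hs⟩ := ih hc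
      exact ⟨_, ContextRed.reaches_fill (.proj l) hc₁,
        hs.mapAsc (ContextRed.reaches_ascOrError hc₁) hc.ascOrError
          fun _ _ _ _ h => .proj _ _ _ _ _ h⟩
  | rcd ls es es' h ih =>
    obtain ⟨i, c, hv, hc, rfl⟩ := hr.rcd_inv
    obtain ⟨c₁, hc₁, hs⟩ := ih i hc
    have hval : ∀ j, ∃ v, j < i → QuietSteps (RL.Red S) (es j) v ∧ IsValue (id : Ev → Ev) v ∧
        v.mapEv some = es' j := fun j => by
      by_cases hj : j < i
      · obtain ⟨v, hv⟩ := (h j).quietSteps_of_isValue_right hassoc (hv j hj)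
        exact ⟨v, fun _ => hv⟩
      -- A dummy value at positions from `i` on, which makes the choice function total.
      · exact ⟨es j, fun h => absurd h hj⟩
    choose vs hvs using hval
    refine ⟨_, ContextRed.reaches_rcd ls es vs i (fun j hj => ⟨(hvs j hj).1, (hvs j hj).2.1⟩) hc₁,
      hs.map fun e e' he => Sim.rcd_update ls i (fun j _ => ?_) he⟩
    by_cases hj : j < i
    · simpa [hj, (hvs j hj).2.2] using Sim.refl hassoc (S := S) (vs j)
    · simpa [hj] using h j

end Sim

theorem mainTheorem3 {Ev Label : Type*} (S : EvidenceAbstraction Ev Label) (hassoc : S.CompAssoc) :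
    IsWeakBisimulation (SimConf S) (RL.Step S) (RLPlus.Step S) := by
  intro c₁ c₂ h
  cases h with
  | error => exact ⟨fun _ h => (nomatch h), fun _ h => (nomatch h)⟩
  | term e₁ e₂ h =>
    refine ⟨fun c₁ h₁ => ?_, fun c₂ h₂ => ?_⟩
    · obtain ⟨c₂, hr, hs⟩ := h.forward hassoc h₁.red
      exact ⟨c₂, hr.reflTransGen fun _ _ h => h.step, hs⟩
    · obtain ⟨c₁, hr, hs⟩ := h.backward hassoc h₂.red
      exact ⟨c₁, hr.reflTransGen fun _ _ h => h.step, hs⟩
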